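/- **Setting.** Let $p$ be a prime, $A$ a $p$-torsion free regular local ring, and $\phi\colon A\to A$ a finite ring homomorphism with $\phi(a)\equiv a^p \bmod p$ for all $a\in A$. Write $\phi^k_*M$ for the restriction of scalars of an $A$-module $M$ along $\phi^k$. Let $s_\phi\colon A\to W(A)$ be the ring homomorphism whose $r$-th ghost component is $\phi^r$ for every $r\ge 0$; regard $W_n(A/p)$ as an $A$-module via $A\to W(A)\to W_n(A/p)$. The ghost component $(a_i)\mapsto\sum_{i\le n-1}p^ia_i^{p^{n-1-i}}$ induces an $A$-linear ring homomorphism $\varphi_{n-1}\colon W_n(A/p)\to\phi^{n-1}_*(A/p^n)$. Let $\omega_A$ be the dualizing module of $A$, with a fixed isomorphism $\iota\colon A\cong\omega_A$, and fix an isomorphism $\kappa\colon\omega_A\cong\phi^!\omega_A=\mathrm{Hom}_A(\phi_*A,\omega_A)$ of $A$-modules, where $A$ acts on the target through $\phi_*A$; it gives the trace $\phi_*\omega_A\to\omega_A$, $w\mapsto\kappa(w)(1)$. Put $\omega_{A/p^n}:=\mathrm{Ext}^1_A(A/p^n,\omega_A)$ and $W_n\omega_{A/p}:=\mathrm{Ext}^1_A(W_n(A/p),\omega_A)$,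 the latter with the $W_n(A/p)$-action induced by that on $W_n(A/p)$. For an $A$-module $M$ let $D_M\colon\phi_*\mathrm{Ext}^1_A(M,\omega_A)\to\mathrm{Ext}^1_A(\phi_*M,\phi_*\omega_A)\to\mathrm{Ext}^1_A(\phi_*M,\omega_A)$ be the duality map (apply $\phi_*$, then the trace), and define it likewise for $\phi^k$ by means of the iterated trace. The trace map of an $A$-linear map $f\colon N\to\phi^k_*M$ is the composition $f^*\colon \phi^k_*\mathrm{Ext}^1_A(M,\omega_A)\to\mathrm{Ext}^1_A(\phi^k_*M,\omega_A)\to\mathrm{Ext}^1_A(N,\omega_A)$. Let - $\iota_n\colon A/p^n\cong\omega_{A/p^n}$ be the isomorphism induced by $\iota$ and the connecting map of $0\to A\xrightarrow{p^n}A\to A/p^n\to0$; - $u:=\iota_n^{-1}\circ\phi^*\circ\phi_*\iota_n\colon\phi_*(A/p^n)\to A/p^n$, where $\phi^*$ is the trace map of $\phi\colon A/p^n\to\phi_*(A/p^n)$; - $T\colon W_n\omega_{A/p}\to W_{n+1}\omega_{A/p}$ be the dual of the restriction $W_{n+1}(A/p)\to W_n(A/p)$, and $T^{n-1}\colon\omega_{A/p}\to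 W_n\omega_{A/p}$ its iterate, where $\omega_{A/p}=W_1\omega_{A/p}$ via $W_1(A/p)=A/p$; - $\lambda_n:=\varphi_{n-1}^*\circ\phi^{n-1}_*\iota_n\colon\phi^{n-1}_*(A/p^n)\to W_n\omega_{A/p}$ for $n\ge1$, where $\varphi_{n-1}^*$ is the trace map of $\varphi_{n-1}$. **Theorem.** The $A$-linear maps $\lambda_n$ satisfy the following. - **(C1)** For $n\ge1$, $r\ge0$ and $a,b\in A/p^n$, $$V^r[b]\cdot\lambda_n(a)=p^r\lambda_n\bigl(ab^{p^{n-1-r}}\bigr),$$ where $[b]$ is the Teichmüller lift of $b\bmod p$ (for $r\ge n$ both sides are $0$, whatever the exponent is taken to be). - **(C2)** For $n\ge2$ and $a\in A/p^{n-1}$, $\lambda_n(pa)=T(\lambda_{n-1}(u(a)))$, where $pa\in A/p^n$. - **(C3)** For $n\ge2$ the duality map $D_{W_{n-1}(A/p)}\colon\phi_*W_{n-1}\omega_{A/p}\to\mathrm{Ext}^1_A(\phi_*W_{n-1}(A/p),\omega_A)$ is an isomorphism. Let $V^*\colon W_n\omega_{A/p}\to\phi_*W_{n-1}\omega_{A/p}$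 be the dual of $V\colon\phi_*W_{n-1}(A/p)\to W_n(A/p)$, followed by $D_{W_{n-1}(A/p)}^{-1}$. Then the diagram of $A$-modules $$\begin{array}{ccccccccc}0&\to&\phi^{n-1}_*A/p&\xrightarrow{\ p^{n-1}\ }&\phi^{n-1}_*A/p^n&\xrightarrow{\ \pi\ }&\phi^{n-1}_*A/p^{n-1}&\to&0\\&&\downarrow{\scriptstyle\iota_1\circ u^{n-1}}&&\downarrow{\scriptstyle\lambda_n}&&\downarrow{\scriptstyle\phi_*\lambda_{n-1}}&&\\0&\to&\omega_{A/p}&\xrightarrow{\ T^{n-1}\ }&W_n\omega_{A/p}&\xrightarrow{\ V^*\ }&\phi_*W_{n-1}\omega_{A/p}&\to&0\end{array}$$ commutes and has exact rows. -/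

import Mathlib

open CategoryTheory CategoryTheory.Abelian WittVector

universe u

noncomputable section

namespace WittDual

/-- The data on which the constructions below depend, for a prime `p` and a commutative ring `A`:
a finite lift of Frobenius `φ` on the `p`-torsion free ring `A`, an `A`-module `ω` (the dualizing
module) with an isomorphism `ι : A ≅ ω`, and an identification `κ` of `ω` with
`φ^! ω = Hom_A(φ_* A, ω)`, which is what is needed to speak of the trace `φ_* ω ⟶ ω` of `φ`. -/
structure DualizingDatum (p : ℕ) (A : Type u) [CommRing A] where
  /-- the lift of Frobenius -/
  φ : A →+* A
  lift : ∀ a : A, φ a - a ^ p ∈ Ideal.span {(p : A)}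
  finite : φ.Finite
  torsionFree : (p : A) ∈ nonZeroDivisors A
  /-- the dualizing module -/
  ω : ModuleCat.{u} A
  ι : ModuleCat.of A A ≅ ω
  κ : ω ≅ (ModuleCat.coextendScalars φ).obj ω

/-! ### The homomorphism `s_φ : A → W(A)` -/

section Dwork

variable {p : ℕ} {A : Type u} [CommRing A]

/-- The Witt coordinates of `s_φ(a)`, solving `∑_{i ≤ n} p^i x_i^{p^{n-i}} = φ^n(a)`
recursively. -/
def dworkCoeff (p : ℕ) (φ : A →+* A) (a : A) : ℕ → A
  | n => Classical.epsilon fun c : A =>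
      (p : A) ^ n * c = (φ ^ n) a -
        ∑ i : Fin n, (p : A) ^ (i : ℕ) * dworkCoeff p φ a i ^ p ^ (n - (i : ℕ))
  decreasing_by exact i.2

lemma sum_dworkCoeff (φ : A →+* A) (hφ : ∀ a : A, φ a - a ^ p ∈ Ideal.span {(p : A)})
    (a : A) (n : ℕ) :
    ∑ i ∈ Finset.range (n + 1), (p : A) ^ i * dworkCoeff p φ a i ^ p ^ (n - i) = (φ ^ n) a := by
  have key : ∀ n, (∃ c : A, (p : A) ^ n * c = (φ ^ n) a -
        ∑ i : Fin n, (p : A) ^ (i : ℕ) * dworkCoeff p φ a i ^ p ^ (n - (i : ℕ))) →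
      ∑ i ∈ Finset.range (n + 1), (p : A) ^ i * dworkCoeff p φ a i ^ p ^ (n - i) =
        (φ ^ n) a := by
    intro n h
    have h2 := Classical.epsilon_spec h
    rw [Finset.sum_range_succ, ← Fin.sum_univ_eq_sum_range
      (fun i => (p : A) ^ i * dworkCoeff p φ a i ^ p ^ (n - i)), Nat.sub_self, pow_zero, pow_one,
      dworkCoeff, h2]
    ring
  induction n with
  | zero => exact key 0 ⟨a, by simp⟩
  | succ n ih =>
    apply key
    have h1 : (φ ^ (n + 1)) a = φ ((φ ^ n) a) := by
      rw [pow_succ']; rfl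
    rw [h1, ← ih, Fin.sum_univ_eq_sum_range
      (fun i => (p : A) ^ i * dworkCoeff p φ a i ^ p ^ (n + 1 - i)), map_sum,
      ← Finset.sum_sub_distrib]
    have : (p : A) ^ (n + 1) ∣ ∑ i ∈ Finset.range (n + 1),
        (φ ((p : A) ^ i * dworkCoeff p φ a i ^ p ^ (n - i)) -
          (p : A) ^ i * dworkCoeff p φ a i ^ p ^ (n + 1 - i)) := by
      refine Finset.dvd_sum fun i hi => ?_
      have hi' : i ≤ n := Nat.lt_succ_iff.mp (Finset.mem_range.mp hi)
      rw [map_mul, map_pow, map_pow, map_natCast, ← mul_sub,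
        show n + 1 - i = (n - i) + 1 by omega, pow_succ' p, pow_mul,
        show (p : A) ^ (n + 1) = (p : A) ^ i * (p : A) ^ (n - i + 1) by
          rw [← pow_add]; congr 1; omega]
      exact mul_dvd_mul_left _
        (dvd_sub_pow_of_dvd_sub (Ideal.mem_span_singleton.mp (hφ _)) (n - i))
    obtain ⟨c, hc⟩ := this
    exact ⟨c, hc.symm⟩

lemma ghost_injective [hp : Fact p.Prime] (htf : (p : A) ∈ nonZeroDivisors A) {x y : WittVector p A}
    (h : ∀ n, ghostComponent n x = ghostComponent n y) : x = y := by
  ext n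
  induction n using Nat.strong_induction_on with
  | _ n ih =>
    have hn := h n
    rw [ghostComponent_apply, ghostComponent_apply, aeval_wittPolynomial, aeval_wittPolynomial,
      Finset.sum_range_succ, Finset.sum_range_succ, Finset.sum_congr rfl fun i hi => by
        rw [ih i (Finset.mem_range.mp hi)]] at hn
    have hn' := add_left_cancel hn
    simp only [Nat.sub_self, pow_zero, pow_one] at hn'
    exact (mul_cancel_left_mem_nonZeroDivisors (pow_mem htf n)).mp hn'

end Dwork

variable {p : ℕ} [hp : Fact p.Prime] {A : Type u} [CommRing A] (D : DualizingDatum p A)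

/-- `s_φ : A → W(A)`, the ring homomorphism whose `n`-th ghost component is `φ^n`. -/
def sW : A →+* WittVector p A where
  toFun a := WittVector.mk p (dworkCoeff p D.φ a)
  map_one' := ghost_injective D.torsionFree fun n => by
    rw [ghostComponent_apply, aeval_wittPolynomial]
    simpa using sum_dworkCoeff D.φ D.lift 1 n
  map_mul' a b := ghost_injective D.torsionFree fun n => by
    rw [map_mul]
    simp only [ghostComponent_apply, aeval_wittPolynomial, coeff_mk]
    simp only [sum_dworkCoeff D.φ D.lift, map_mul]
  map_zero' := ghost_injective D.torsionFree fun n => by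
    rw [ghostComponent_apply, aeval_wittPolynomial, map_zero]
    simpa using sum_dworkCoeff D.φ D.lift 0 n
  map_add' a b := ghost_injective D.torsionFree fun n => by
    rw [map_add]
    simp only [ghostComponent_apply, aeval_wittPolynomial, coeff_mk]
    simp only [sum_dworkCoeff D.φ D.lift, map_add]

lemma ghostComponent_sW (n : ℕ) (a : A) : ghostComponent n (sW D a) = (D.φ ^ n) a := by
  rw [ghostComponent_apply, aeval_wittPolynomial]
  exact sum_dworkCoeff D.φ D.lift a n

lemma frobenius_sW (a : A) : frobenius (sW D a) = sW D (D.φ a) :=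
  ghost_injective D.torsionFree fun n => by
    rw [ghostComponent_frobenius, ghostComponent_sW, ghostComponent_sW, pow_succ]
    rfl

/-- An additive map `g : M → N` with `g (f(a) x) = a g(x)`, as an `A`-linear map `f_* M → N`. -/
def fromPush (f : A →+* A) {M N : ModuleCat.{u} A} (g : M →+ N)
    (h : ∀ (a : A) (x : M), g (f a • x) = a • g x) :
    (ModuleCat.restrictScalars f).obj M ⟶ N :=
  ModuleCat.ofHom (X := (ModuleCat.restrictScalars f).obj M) (Y := N)
    (@LinearMap.mk A A _ _ (RingHom.id A) _ _ _ _ _ _ ⟨g, g.map_add⟩ h)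

/-- An additive map `g : M → N` with `g (a x) = f(a) g(x)`, as an `A`-linear map `M → f_* N`. -/
def toPush (f : A →+* A) {M N : ModuleCat.{u} A} (g : M →+ N)
    (h : ∀ (a : A) (x : M), g (a • x) = f a • g x) :
    M ⟶ (ModuleCat.restrictScalars f).obj N :=
  ModuleCat.ofHom (X := M) (Y := (ModuleCat.restrictScalars f).obj N)
    (@LinearMap.mk A A _ _ (RingHom.id A) _ _ _ _ _ _ ⟨g, g.map_add⟩ h)

/-! ### The `A`-modules `W_n(A/p)` and `A/p^n` and the maps between them -/

variable (p A) in
/-- The ring `W_n(A/p)`. -/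
abbrev W (n : ℕ) : Type u := TruncatedWittVector p n (A ⧸ Ideal.span {(p : A)})

variable (p A) in
/-- The ring `A/p^n`. -/
abbrev Q (n : ℕ) : Type u := A ⧸ (Ideal.span {(p : A)} ^ n)

/-- `A → W(A) → W(A/p) → W_n(A/p)`, the first map being `s_φ`. -/
def sWn (n : ℕ) : A →+* W p A n :=
  (WittVector.truncate n).comp
    ((WittVector.map (Ideal.Quotient.mk (Ideal.span {(p : A)}))).comp (sW D))

/-- `W_n(A/p)` as an `A`-module via `s_φ`. -/
def WMod (n : ℕ) : ModuleCat.{u} A :=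
  (ModuleCat.restrictScalars (sWn D n)).obj (ModuleCat.of (W p A n) (W p A n))

variable (p A) in
/-- `A/p^n` as an `A`-module. -/
def QMod (n : ℕ) : ModuleCat.{u} A := ModuleCat.of A (Q p A n)

/-- `φ^k_* M`, the restriction of scalars of `M` along the `k`-th iterate of `φ`. -/
abbrev push (k : ℕ) : ModuleCat.{u} A ⥤ ModuleCat.{u} A := ModuleCat.restrictScalars (D.φ ^ k)

/-- `φ_* φ^k_* M = φ^{k+1}_* M` (the identity map). -/
def pushSucc (k : ℕ) (M : ModuleCat.{u} A) :
    (push D (k + 1)).obj M ≅ (ModuleCat.restrictScalars D.φ).obj ((push D k).obj M) :=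
  ModuleCat.restrictScalarsComp'App D.φ (D.φ ^ k) (D.φ ^ (k + 1)) (pow_succ D.φ k) M

/-- The restriction map `W_{n+1}(A/p) → W_n(A/p)`. -/
def res (n : ℕ) : WMod D (n + 1) ⟶ WMod D n :=
  ModuleCat.ofHom (X := WMod D (n + 1)) (Y := WMod D n)
    { toFun := fun x : W p A (n + 1) =>
        (TruncatedWittVector.truncate (Nat.le_succ n) x : W p A n)
      map_add' := fun x y => map_add (TruncatedWittVector.truncate (Nat.le_succ n)) x y
      map_smul' := fun a x => by
        refine (map_mul (TruncatedWittVector.truncate (Nat.le_succ n)) (sWn D (n + 1) a) x).trans ?_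
        have h : TruncatedWittVector.truncate (Nat.le_succ n) (sWn D (n + 1) a) = sWn D n a :=
          TruncatedWittVector.truncate_wittVector_truncate (Nat.le_succ n)
            (WittVector.map (Ideal.Quotient.mk (Ideal.span {(p : A)})) (sW D a))
        exact congrArg
          (fun t : W p A n => t * TruncatedWittVector.truncate (Nat.le_succ n) x) h }

variable (p A) in
/-- The shift `V : W_n(A/p) → W_{n+1}(A/p)`, `(a_0, …, a_{n-1}) ↦ (0, a_0, …, a_{n-1})`. -/
def verFun (n : ℕ) (x : W p A n) : W p A (n + 1) :=
  WittVector.truncate (n + 1) (verschiebung x.out)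

lemma verFun_truncate (n : ℕ) (x : WittVector p (A ⧸ Ideal.span {(p : A)})) :
    verFun p A n (WittVector.truncate n x) = WittVector.truncate (n + 1) (verschiebung x) := by
  ext i
  rw [verFun, coeff_truncate, coeff_truncate]
  rcases i with ⟨_ | i, hi⟩
  · simp [verschiebung_coeff_zero]
  · simp only [verschiebung_coeff_add_one]
    have h : i < n := by omega
    rw [show i = ((⟨i, h⟩ : Fin n) : ℕ) from rfl, TruncatedWittVector.coeff_out, coeff_truncate]

variable (p A) in
/-- The additive map `V : W_n(A/p) → W_{n+1}(A/p)`. -/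
def verAdd (n : ℕ) : W p A n →+ W p A (n + 1) :=
  AddMonoidHom.mk' (verFun p A n) fun x y => by
    obtain ⟨x, rfl⟩ := WittVector.truncate_surjective p n _ x
    obtain ⟨y, rfl⟩ := WittVector.truncate_surjective p n _ y
    rw [← map_add, verFun_truncate, verFun_truncate, verFun_truncate, map_add, map_add]

/-- `V : φ_* W_n(A/p) → W_{n+1}(A/p)` as a homomorphism of `A`-modules. -/
def ver (n : ℕ) : (ModuleCat.restrictScalars D.φ).obj (WMod D n) ⟶ WMod D (n + 1) :=
  fromPush D.φ (M := WMod D n) (N := WMod D (n + 1))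
    (verAdd p A n)
    (fun a x => by
      obtain ⟨x, rfl⟩ := WittVector.truncate_surjective p n _ x
      set r : A →+* WittVector p (A ⧸ Ideal.span {(p : A)}) :=
        (WittVector.map (Ideal.Quotient.mk (Ideal.span {(p : A)}))).comp (sW D) with hr
      have h1 : r (D.φ a) = frobenius (r a) := by
        simp only [hr, RingHom.comp_apply, ← frobenius_sW]
        exact (frobenius_isPoly p).map _ _
      change verFun p A n (WittVector.truncate n (r (D.φ a)) * WittVector.truncate n x) =
        WittVector.truncate (n + 1) (r a) * verFun p A n (WittVector.truncate n x)
      rw [← map_mul, verFun_truncate, verFun_truncate, ← map_mul, h1, mul_comm,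
        verschiebung_mul_frobenius, mul_comm])

lemma ker_truncate_le (m : ℕ) :
    RingHom.ker (WittVector.truncate (p := p) (R := A ⧸ Ideal.span {(p : A)}) (m + 1)) ≤
      RingHom.ker (ghostComponentModPPow (R := A) (p := p) m) := by
  intro x hx
  rw [WittVector.mem_ker_truncate] at hx
  choose f hf using fun i => Ideal.Quotient.mk_surjective (x.coeff i)
  have h : x = WittVector.map (Ideal.Quotient.mk (Ideal.span {(p : A)})) (WittVector.mk p f) := by
    ext i
    rw [WittVector.map_coeff, coeff_mk, hf]
  rw [RingHom.mem_ker, h, ghostComponentModPPow_map_mk, Ideal.Quotient.eq_zero_iff_mem,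
    Ideal.span_singleton_pow, Ideal.mem_span_singleton]
  refine pow_dvd_ghostComponent_of_dvd_coeff fun i hi => ?_
  rw [coeff_mk, ← Ideal.mem_span_singleton, ← Ideal.Quotient.eq_zero_iff_mem, hf]
  exact hx i (by omega)

variable (p A) in
/-- The ring homomorphism `W_{m+1}(A/p) → A/p^{m+1}` induced by the ghost component
`(a_i) ↦ ∑_{i ≤ m} p^i a_i^{p^{m-i}}`. -/
def ghostRingHom (m : ℕ) : W p A (m + 1) →+* Q p A (m + 1) :=
  RingHom.liftOfSurjective (WittVector.truncate (m + 1)) (WittVector.truncate_surjective p _ _)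
    ⟨ghostComponentModPPow m, ker_truncate_le m⟩

lemma ghostRingHom_truncate (m : ℕ) (x : WittVector p (A ⧸ Ideal.span {(p : A)})) :
    ghostRingHom p A m (WittVector.truncate (m + 1) x) = ghostComponentModPPow m x :=
  RingHom.liftOfSurjective_comp_apply ..

lemma ghostRingHom_sWn (m : ℕ) (a : A) :
    ghostRingHom p A m (sWn D (m + 1) a) = Ideal.Quotient.mk _ ((D.φ ^ m) a) := by
  rw [sWn, RingHom.comp_apply, RingHom.comp_apply, ghostRingHom_truncate,
    ghostComponentModPPow_map_mk, ghostComponent_sW]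


/-- The ghost component `φ_m : W_{m+1}(A/p) → φ^m_* (A/p^{m+1})` as a homomorphism of
`A`-modules. -/
def ghost (m : ℕ) : WMod D (m + 1) ⟶ (push D m).obj (QMod p A (m + 1)) :=
  toPush (D.φ ^ m) (M := WMod D (m + 1)) (N := QMod p A (m + 1))
    (ghostRingHom p A m).toAddMonoidHom (fun a x => by
      refine (map_mul (ghostRingHom p A m) (sWn D (m + 1) a) x).trans ?_
      rw [ghostRingHom_sWn]
      rfl)

variable (p A) in
/-- The natural surjection `π : A/p^{n+1} → A/p^n`. -/
def proj (n : ℕ) : QMod p A (n + 1) ⟶ QMod p A n :=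
  ModuleCat.ofHom (X := QMod p A (n + 1)) (Y := QMod p A n)
    (Submodule.mapQ _ _ LinearMap.id (Ideal.pow_le_pow_right (Nat.le_succ n)))

variable (p A) in
/-- Multiplication by `p^j`, as a map `A/p^n → A/p^k` for `k = n + j`: it sends `a mod p^n` to
`p^j a mod p^k`. -/
def mulPow (n j k : ℕ) (h : n + j = k) : QMod p A n ⟶ QMod p A k :=
  ModuleCat.ofHom (X := QMod p A n) (Y := QMod p A k)
    (Submodule.mapQ (Ideal.span {(p : A)} ^ n) (Ideal.span {(p : A)} ^ k)
      (LinearMap.mulLeft A ((p : A) ^ j)) (fun x hx => by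
        rw [Submodule.mem_comap, LinearMap.mulLeft_apply, ← h, add_comm n j, pow_add]
        exact Ideal.mul_mem_mul (Ideal.pow_mem_pow (Ideal.mem_span_singleton_self _) j) hx))

/-! ### Duals and trace maps -/

/-- `Ext^1_A(M, ω)` as an `A`-module. -/
abbrev extDual (M : ModuleCat.{u} A) : ModuleCat.{u} A := ModuleCat.of A (Ext M D.ω 1)

/-- The map `Ext^1_A(N, ω) → Ext^1_A(M, ω)` induced by `f : M → N`. -/
def extMap {M N : ModuleCat.{u} A} (f : M ⟶ N) : extDual D N ⟶ extDual D M :=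
  ModuleCat.ofHom (X := extDual D N) (Y := extDual D M)
    { toFun := fun e : Ext N D.ω 1 => (Ext.mk₀ f).comp e (zero_add 1)
      map_add' := fun _ _ => Ext.comp_add _ _ _ _
      map_smul' := fun _ _ => Ext.comp_smul _ _ _ _ }

/-- The trace `φ_* ω → ω`: it sends `w` to `κ(w)(1)`. -/
def trace : (ModuleCat.restrictScalars D.φ).obj D.ω ⟶ D.ω :=
  (ModuleCat.restrictScalars D.φ).map D.κ.hom ≫
    (ModuleCat.restrictCoextendScalarsAdj D.φ).counit.app D.ω

/-- The iterated trace `φ^k_* ω → ω`. -/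
def traceIter : (k : ℕ) → ((push D k).obj D.ω ⟶ D.ω)
  | 0 => (ModuleCat.restrictScalarsId'App (D.φ ^ 0) (pow_zero D.φ) D.ω).hom
  | k + 1 => (pushSucc D k D.ω).hom ≫
      (ModuleCat.restrictScalars D.φ).map (traceIter k) ≫ trace D

/-- For a ring endomorphism `f` and an `A`-linear map `t : f_* ω → ω`, the map
`f_* Ext^1_A(M, ω) → Ext^1_A(f_* M, f_* ω) → Ext^1_A(f_* M, ω)`: apply the exact functor `f_*`,
then compose with `t`. -/
def dualityMap (f : A →+* A) (t : (ModuleCat.restrictScalars f).obj D.ω ⟶ D.ω)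
    (M : ModuleCat.{u} A) :
    (ModuleCat.restrictScalars f).obj (extDual D M) ⟶
      extDual D ((ModuleCat.restrictScalars f).obj M) :=
  fromPush f (M := extDual D M) (N := extDual D ((ModuleCat.restrictScalars f).obj M))
    (AddMonoidHom.mk' (fun e : Ext M D.ω 1 =>
        (e.mapExactFunctor (ModuleCat.restrictScalars f)).comp (Ext.mk₀ t) (add_zero 1))
      fun e e' => by rw [Ext.mapExactFunctor_add, Ext.add_comp])
    (fun a (e : Ext M D.ω 1) => by
      have h1 : (ModuleCat.restrictScalars f).map (f a • 𝟙 D.ω) ≫ t = t ≫ (a • 𝟙 D.ω) := by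
        ext x
        exact t.hom.map_smul a x
      have h2 := Ext.smul_eq_comp_mk₀ e (f a)
      change (Ext.mapExactFunctor (ModuleCat.restrictScalars f) (f a • e)).comp
          (Ext.mk₀ t) (add_zero 1) =
        a • ((Ext.mapExactFunctor (ModuleCat.restrictScalars f) e).comp (Ext.mk₀ t) (add_zero 1))
      rw [h2, Ext.mapExactFunctor_comp, Ext.mapExactFunctor_mk₀, Ext.smul_eq_comp_mk₀,
        Ext.comp_assoc_of_second_deg_zero, Ext.mk₀_comp_mk₀, h1, ← Ext.mk₀_comp_mk₀,
        Ext.comp_assoc_of_second_deg_zero])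

/-- The duality map `φ_* Ext^1_A(M, ω) → Ext^1_A(φ_* M, ω)` of the finite morphism `φ`. -/
abbrev duality (M : ModuleCat.{u} A) := dualityMap D D.φ (trace D) M

/-- The duality map `φ^k_* Ext^1_A(M, ω) → Ext^1_A(φ^k_* M, ω)` of `φ^k`. -/
abbrev dualityIter (k : ℕ) (M : ModuleCat.{u} A) := dualityMap D (D.φ ^ k) (traceIter D k) M

/-- `ω_{A/p^n} = Ext^1_A(A/p^n, ω)`. -/
abbrev omegaQ (n : ℕ) : ModuleCat.{u} A := extDual D (QMod p A n)

/-- `W_nω_{A/p} = Ext^1_A(W_n(A/p), ω)`. -/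
abbrev omegaW (n : ℕ) : ModuleCat.{u} A := extDual D (WMod D n)

/-- Multiplication by `x ∈ W_n(A/p)` as an `A`-linear endomorphism of `W_n(A/p)`. -/
def mulW (n : ℕ) (x : W p A n) : WMod D n ⟶ WMod D n :=
  ModuleCat.ofHom (X := WMod D n) (Y := WMod D n)
    { toFun := fun y : W p A n => x * y
      map_add' := fun y z => mul_add x y z
      map_smul' := fun a y => mul_left_comm x (sWn D n a) y }

/-- The `W_n(A/p)`-module structure of `W_nω_{A/p}`, induced by that of `W_n(A/p)`. -/
instance instModuleOmegaW (n : ℕ) : Module (W p A n) (omegaW D n) where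
  smul x e := (extMap D (mulW D n x)).hom e
  one_smul := fun (e : Ext (WMod D n) D.ω 1) => by
    have h : mulW D n 1 = 𝟙 _ := by ext y; exact one_mul (M := W p A n) y
    change (Ext.mk₀ (mulW D n 1)).comp e (zero_add 1) = e
    rw [h, Ext.mk₀_id_comp]
  mul_smul := fun x y (e : Ext (WMod D n) D.ω 1) => by
    have h' : mulW D n (x * y) = mulW D n x ≫ mulW D n y := by
      rw [mul_comm]
      ext z
      exact mul_assoc (G := W p A n) y x z
    change (Ext.mk₀ (mulW D n (x * y))).comp e (zero_add 1) =
      (Ext.mk₀ (mulW D n x)).comp ((Ext.mk₀ (mulW D n y)).comp e (zero_add 1)) (zero_add 1)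
    rw [h', Ext.mk₀_comp_mk₀_assoc]
  smul_zero x := map_zero (extMap D (mulW D n x)).hom
  smul_add x e e' := map_add (extMap D (mulW D n x)).hom e e'
  add_smul := fun x y (e : Ext (WMod D n) D.ω 1) => by
    have h : mulW D n (x + y) = mulW D n x + mulW D n y := by
      ext z
      exact add_mul (R := W p A n) x y z
    change (Ext.mk₀ (mulW D n (x + y))).comp e (zero_add 1) =
      (Ext.mk₀ (mulW D n x)).comp e (zero_add 1) + (Ext.mk₀ (mulW D n y)).comp e (zero_add 1)
    rw [h, Ext.mk₀_add, Ext.add_comp]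
  zero_smul := fun (e : Ext (WMod D n) D.ω 1) => by
    have h : mulW D n 0 = 0 := by ext z; exact zero_mul (M₀ := W p A n) z
    change (Ext.mk₀ (mulW D n 0)).comp e (zero_add 1) = 0
    rw [h, Ext.mk₀_zero, Ext.zero_comp]

/-- The trace map `T : W_nω_{A/p} → W_{n+1}ω_{A/p}`, the dual of the restriction map. -/
def T (n : ℕ) : omegaW D n ⟶ omegaW D (n + 1) := extMap D (res D n)

/-! ### The isomorphisms `ι_n`, the maps `u` and `λ_n` -/

/-- The sequence `0 → A → A → A/p^n → 0`, the first map being multiplication by `p^n`. -/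
abbrev powSeq (_ : DualizingDatum p A) (n : ℕ) : ShortComplex (ModuleCat.{u} A) :=
  ShortComplex.mk (X₁ := ModuleCat.of A A) (X₂ := ModuleCat.of A A) (X₃ := QMod p A n)
    (ModuleCat.ofHom (LinearMap.mulLeft A ((p : A) ^ n)))
    (ModuleCat.ofHom (Y := QMod p A n) (Submodule.mkQ (Ideal.span {(p : A)} ^ n))) (by
      ext
      refine (Ideal.Quotient.eq_zero_iff_mem).mpr ?_
      exact Ideal.mul_mem_right _ _ (Ideal.pow_mem_pow (Ideal.mem_span_singleton_self _) n))

set_option linter.unusedSectionVars false in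
lemma powSeq_shortExact (n : ℕ) : (powSeq D n).ShortExact where
  exact := by
    rw [ShortComplex.ShortExact.moduleCat_exact_iff_function_exact]
    intro x
    refine (Ideal.Quotient.eq_zero_iff_mem (I := Ideal.span {(p : A)} ^ n)).trans ?_
    refine (by rw [Ideal.span_singleton_pow, Ideal.mem_span_singleton] :
      ((x : A) ∈ Ideal.span {(p : A)} ^ n) ↔ (p : A) ^ n ∣ (x : A)).trans ?_
    exact ⟨fun ⟨c, hc⟩ => ⟨c, hc.symm⟩, fun ⟨c, hc⟩ => ⟨c, hc.symm⟩⟩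
  mono_f := by
    rw [ModuleCat.mono_iff_injective]
    intro x y h
    exact (mul_cancel_left_mem_nonZeroDivisors (pow_mem D.torsionFree n)).mp h
  epi_g := by
    rw [ModuleCat.epi_iff_surjective]
    exact Submodule.mkQ_surjective _

/-- The `A`-linear map `A → ω` with `1 ↦ ι(a)`. -/
def iotaMul (a : A) : ModuleCat.of A A ⟶ D.ω := a • D.ι.hom

set_option linter.unusedSectionVars false in
lemma inv_iotaMul_one (a : A) : D.ι.inv.hom ((iotaMul D a).hom (1 : A)) = a := by
  change D.ι.inv.hom (a • D.ι.hom.hom (1 : A)) = a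
  rw [map_smul]
  have h : D.ι.inv.hom (D.ι.hom.hom (1 : A)) = (1 : A) :=
    ConcreteCategory.congr_hom D.ι.hom_inv_id (1 : A)
  rw [h, smul_eq_mul, mul_one]

/-- The connecting map `A ≅ Hom_A(A, ω) → Ext^1_A(A/p^n, ω)` of the sequence
`0 → A → A → A/p^n → 0`, the isomorphism being the one given by `ι`. -/
def iotaLift (n : ℕ) : A →ₗ[A] Ext (QMod p A n) D.ω 1 where
  toFun a := (powSeq_shortExact D n).extClass.comp (Ext.mk₀ (iotaMul D a)) (add_zero 1)
  map_add' a b := by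
    have h : iotaMul D (a + b) = iotaMul D a + iotaMul D b := add_smul _ _ _
    rw [h, Ext.mk₀_add, Ext.comp_add]
  map_smul' r a := by
    have h : iotaMul D (r • a) = r • iotaMul D a := mul_smul _ _ _
    rw [h, Ext.mk₀_smul, Ext.comp_smul, RingHom.id_apply]

lemma iotaLift_eq_zero_iff (n : ℕ) (a : A) :
    iotaLift D n a = 0 ↔ a ∈ Ideal.span {(p : A)} ^ n := by
  rw [Ideal.span_singleton_pow, Ideal.mem_span_singleton]
  constructor
  · intro h
    obtain ⟨x, hx⟩ := Ext.contravariant_sequence_exact₁ (powSeq_shortExact D n) D.ω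
      (Ext.mk₀ (iotaMul D a)) (add_zero 1) h
    obtain ⟨g, rfl⟩ := (Ext.mk₀_bijective _ _).2 x
    rw [Ext.mk₀_comp_mk₀] at hx
    have h2 := (Ext.mk₀_bijective _ _).1 hx
    have h3 := congrArg (fun t => D.ι.inv.hom (t.hom (1 : A))) h2
    refine ⟨D.ι.inv.hom (g.hom (1 : A)), ?_⟩
    have h5 : (ModuleCat.Hom.hom ((powSeq D n).f ≫ g)) (1 : A) = (p : A) ^ n • g.hom (1 : A) := by
      rw [← map_smul]
      rfl
    have h6 : D.ι.inv.hom ((p : A) ^ n • g.hom (1 : A)) = a :=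
      (congrArg (fun t => D.ι.inv.hom t) h5.symm).trans (h3.trans (inv_iotaMul_one D a))
    rw [map_smul] at h6
    exact h6.symm
  · rintro ⟨c, rfl⟩
    have : iotaMul D ((p : A) ^ n * c) = (powSeq D n).f ≫ iotaMul D c := by
      ext
      change ((p : A) ^ n * c) • D.ι.hom.hom (1 : A) = c • D.ι.hom.hom ((p : A) ^ n * 1)
      rw [mul_comm _ (1 : A), one_mul, ← map_smul, ← map_smul, smul_eq_mul, smul_eq_mul, mul_one,
        mul_comm]
    change (powSeq_shortExact D n).extClass.comp (Ext.mk₀ (iotaMul D _)) (add_zero 1) = 0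
    rw [this, ← Ext.mk₀_comp_mk₀, ShortComplex.ShortExact.extClass_comp_assoc]

lemma iotaLift_surjective (n : ℕ) : Function.Surjective (iotaLift D n) := by
  intro e
  obtain ⟨x, hx⟩ := Ext.contravariant_sequence_exact₃ (powSeq_shortExact D n) D.ω e
    (@Ext.eq_zero_of_projective _ _ _ _ (ModuleCat.of A A) _ _
      (ModuleCat.projective_of_free (Module.Basis.singleton Unit A)) _) (add_zero 1)
  obtain ⟨g, rfl⟩ := (Ext.mk₀_bijective _ _).2 x
  refine ⟨D.ι.inv.hom (g.hom (1 : A)), ?_⟩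
  have : iotaMul D (D.ι.inv.hom (g.hom (1 : A))) = g := by
    ext
    change D.ι.inv.hom (g.hom (1 : A)) • D.ι.hom.hom (1 : A) = g.hom (1 : A)
    rw [← map_smul, smul_eq_mul, mul_one]
    exact ConcreteCategory.congr_hom D.ι.inv_hom_id (g.hom (1 : A))
  change (powSeq_shortExact D n).extClass.comp (Ext.mk₀ (iotaMul D _)) (add_zero 1) = _
  rw [this, hx]

/-- The isomorphism `ι_n : A/p^n ≅ ω_{A/p^n}` induced by `ι`. -/
def iota (n : ℕ) : QMod p A n ≅ omegaQ D n :=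
  (LinearEquiv.ofBijective
    (Submodule.liftQ (Ideal.span {(p : A)} ^ n) (iotaLift D n)
      (fun a ha => (iotaLift_eq_zero_iff D n a).mpr ha))
    ⟨by
      rw [← LinearMap.ker_eq_bot]
      exact Submodule.ker_liftQ_eq_bot _ _ _ fun a ha => (iotaLift_eq_zero_iff D n a).mp ha,
    fun e => by
      obtain ⟨a, rfl⟩ := iotaLift_surjective D n e
      exact ⟨Submodule.Quotient.mk a, rfl⟩⟩).toModuleIso

/-- `φ : A/p^n → φ_* (A/p^n)`. -/
def frobQ (n : ℕ) : QMod p A n ⟶ (ModuleCat.restrictScalars D.φ).obj (QMod p A n) :=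
  toPush D.φ (M := QMod p A n) (N := QMod p A n)
    (Ideal.quotientMap (Ideal.span {(p : A)} ^ n) D.φ (by
      rw [← Ideal.map_le_iff_le_comap, Ideal.map_pow, Ideal.map_span, Set.image_singleton,
        map_natCast]) : Q p A n →+* Q p A n).toAddMonoidHom
    (fun a x => by
      obtain ⟨x, rfl⟩ := Ideal.Quotient.mk_surjective x
      exact congrArg (Ideal.Quotient.mk (Ideal.span {(p : A)} ^ n)) (map_mul D.φ a x))

/-- `u : φ_* (A/p^n) → φ_* ω_{A/p^n} → ω_{A/p^n} → A/p^n`, the composition of `φ_* ι_n`, the trace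
map of `φ : A/p^n → φ_* (A/p^n)`, and `ι_n⁻¹`. -/
def u (n : ℕ) : (ModuleCat.restrictScalars D.φ).obj (QMod p A n) ⟶ QMod p A n :=
  (ModuleCat.restrictScalars D.φ).map (iota D n).hom ≫ duality D (QMod p A n) ≫
    extMap D (frobQ D n) ≫ (iota D n).inv

/-- `u^k : φ^k_* (A/p^n) → A/p^n`. -/
def uIter (n : ℕ) : (k : ℕ) → ((push D k).obj (QMod p A n) ⟶ QMod p A n)
  | 0 => (ModuleCat.restrictScalarsId'App (D.φ ^ 0) (pow_zero D.φ) (QMod p A n)).hom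
  | k + 1 => (pushSucc D k (QMod p A n)).hom ≫
      (ModuleCat.restrictScalars D.φ).map (uIter n k) ≫ u D n

/-- The trace map `φ_m^* : φ^m_* ω_{A/p^{m+1}} → W_{m+1}ω_{A/p}` of the ghost component
`φ_m : W_{m+1}(A/p) → φ^m_* (A/p^{m+1})`. -/
def ghostDual (m : ℕ) : (push D m).obj (omegaQ D (m + 1)) ⟶ omegaW D (m + 1) :=
  dualityIter D m (QMod p A (m + 1)) ≫ extMap D (ghost D m)

/-- `lam D m` is `λ_n : φ^{n-1}_* (A/p^n) → W_nω_{A/p}` for `n = m + 1`. -/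
def lam (m : ℕ) : (push D m).obj (QMod p A (m + 1)) ⟶ omegaW D (m + 1) :=
  (push D m).map (iota D (m + 1)).hom ≫ ghostDual D m

/-- `T^m : ω_{A/p} → W_{m+1}ω_{A/p}`, the dual of the `m`-fold restriction map
`W_{m+1}(A/p) → W_1(A/p) = A/p`. -/
def TIter : (m : ℕ) → (omegaQ D 1 ⟶ omegaW D (m + 1))
  | 0 => extMap D (ghost D 0 ≫
      (ModuleCat.restrictScalarsId'App (D.φ ^ 0) (pow_zero D.φ) (QMod p A 1)).hom)
  | m + 1 => TIter m ≫ T D (m + 1)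

/-- `V^* : W_{n+1}ω_{A/p} → φ_* W_nω_{A/p}`, the dual of `V : φ_* W_n(A/p) → W_{n+1}(A/p)`, when the
duality map identifies `φ_* W_nω_{A/p}` with `Ext^1_A(φ_* W_n(A/p), ω)`. -/
def verDual (n : ℕ) [IsIso (duality D (WMod D n))] :
    omegaW D (n + 1) ⟶ (ModuleCat.restrictScalars D.φ).obj (omegaW D n) :=
  extMap D (ver D n) ≫ inv (duality D (WMod D n))

/-- The element `V^r [b]` of `W_{m+1}(A/p)`, for `b ∈ A/p^{m+1}`. -/
def verTeich (m r : ℕ) (b : Q p A (m + 1)) : W p A (m + 1) :=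
  WittVector.truncate (m + 1) (verschiebung^[r] (teichmuller p
    (Ideal.Quotient.factor (Ideal.pow_le_self (Nat.succ_ne_zero m)) b)))

/-- The sequence `0 → X → Y → Z → 0` given by `f` and `g` is exact. -/
def IsShortExact {X Y Z : ModuleCat.{u} A} (f : X ⟶ Y) (g : Y ⟶ Z) : Prop :=
  ∃ w : f ≫ g = 0, (ShortComplex.mk f g w).ShortExact

end WittDual

end

/-! Each assertion about `lam` is the dual of a statement about ghost components. A class in
Ext^1(A/p^n, ω) is the class of 0 → A → A → A/p^n → 0 pushed out along some multiple of ι, and these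
classes are functorial (`extMap_connecting`, `dualityMap_connecting`). To dualize a map between the
modules A/p^n it therefore suffices to lift it to the sequences and to read off its effect on the
left-hand A. The projection A/p^{n+1} → A/p^n acts there as p, so its dual is multiplication by p;
multiplication by p from A/p^n to A/p^{n+1} acts there as the identity, so its dual is the
projection; the dual of φ is the trace, that is, u.

Write w_m for the m-th ghost component. (C1) holds because w_m is a ring homomorphism with
w_m(V^r[b]) = p^r b^{p^{m-r}} for r ≤ m, and 0 otherwise. (C2) is dual to w_{m+1} ≡ φ ∘ w_m mod
p^{m+1} (`ghost_comp_proj`). In (C3) the right square is dual to w_{m+1} ∘ V = p w_m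
(`ver_comp_ghost`), and the left square is an iteration of (C2). The lower row is the dual of 0 →
φ_*W_{m+1}(A/p) → W_{m+2}(A/p) → A/p → 0. It is exact because p-power torsion has no nonzero map to
ω ≅ A and because Ext^2(A/p, ω) = 0.

Regularity of A serves to show that the duality map of φ is an isomorphism. If φ_*A is free, a free
presentation of M reduces this to the adjunction Hom(M, ω) ≅ Hom(φ_*M, ω). Freeness of φ_*A is
Kunz's theorem for A/p, lifted along the nonzerodivisor p; here A/p is regular because a lift of
Frobenius forces p ∉ m^2. If p is a unit, then W_n(A/p) = 0. -/

section RegularLocal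

/-! ### Regular local rings: hyperplane sections and integrality. -/

open IsLocalRing

/-- Dividing a Noetherian local ring by an element of `m \ m ^ 2` lowers the minimal number of
generators of the maximal ideal. -/
theorem IsLocalRing.spanFinrank_maximalIdeal_quotient_lt {R : Type u} [CommRing R] [IsLocalRing R]
    [IsNoetherianRing R] {x : R} (hx : x ∈ maximalIdeal R) (hx2 : x ∉ maximalIdeal R ^ 2)
    [IsLocalRing (R ⧸ Ideal.span {x})] :
    (maximalIdeal (R ⧸ Ideal.span {x})).spanFinrank + 1 ≤ (maximalIdeal R).spanFinrank := by
  classical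
  set k := ResidueField R
  set c := (maximalIdeal R).toCotangent with hc
  set x' : CotangentSpace R := c ⟨x, hx⟩ with hx'
  have hx'0 : x' ≠ 0 := fun h => hx2 ((Ideal.toCotangent_eq_zero _ _).mp h)
  obtain ⟨b, -, hxb, hspan, hli⟩ := exists_linearIndepOn_id_extension (K := k)
    (V := CotangentSpace R) (s := {x'}) (t := Set.univ) (LinearIndepOn.singleton (v := id) hx'0)
    (Set.subset_univ _)
  rw [Set.singleton_subset_iff] at hxb
  let g : CotangentSpace R → maximalIdeal R := Function.surjInv (Ideal.toCotangent_surjective _)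
  have hg : ∀ v, c (g v) = v := Function.surjInv_eq _
  have hspan' : Submodule.span k b = ⊤ := by
    rw [eq_top_iff]; intro v _; exact hspan (Set.mem_univ v)
  have hbfin : b.Finite := hli.finite
  have hcard : b.ncard = (maximalIdeal R).spanFinrank := by
    rw [spanFinrank_maximalIdeal_eq_finrank_cotangentSpace]
    have B : Module.Basis b k (CotangentSpace R) :=
      Module.Basis.mk (v := fun i : b => (i : CotangentSpace R)) hli
        (by rw [Subtype.range_coe]; exact hspan'.ge)
    have := hbfin.fintype
    rw [Module.finrank_eq_card_basis B, Set.ncard_eq_toFinset_card', Set.toFinset_card]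
  set t : Set (maximalIdeal R) := g '' (b \ {x'}) with ht
  -- Nakayama: x and lifts of the other vectors of a basis of m/m^2 through the class of x generate
  -- m. Modulo x one generator disappears.
  have hgen : Submodule.span R (insert ⟨x, hx⟩ t) = ⊤ := by
    rw [← CotangentSpace.span_image_eq_top_iff, Set.image_insert_eq, ht, Set.image_image]
    simp only [← hc, hg, Set.image_id']
    rw [← hx', Set.insert_sdiff_singleton, Set.insert_eq_of_mem hxb]
    exact hspan'
  have hm : maximalIdeal R = Ideal.span (insert x (Subtype.val '' t)) := by
    have := congrArg (Submodule.map (maximalIdeal R).subtype) hgen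
    rw [Submodule.map_top, Submodule.range_subtype, Submodule.map_span, Set.image_insert_eq] at this
    exact this.symm
  have hm' : maximalIdeal (R ⧸ Ideal.span {x}) =
      Ideal.span (Ideal.Quotient.mk (Ideal.span {x}) '' (Subtype.val '' t)) := by
    have h1 : maximalIdeal (R ⧸ Ideal.span {x}) =
        (maximalIdeal R).map (Ideal.Quotient.mk (Ideal.span {x})) :=
      (IsLocalRing.map_maximalIdeal_of_surjective _ Ideal.Quotient.mk_surjective).symm
    rw [h1]
    refine (congrArg (Ideal.map (Ideal.Quotient.mk (Ideal.span {x}))) hm).trans ?_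
    rw [Ideal.map_span, Set.image_insert_eq, Ideal.Quotient.eq_zero_iff_mem.mpr
      (Ideal.mem_span_singleton_self x), Ideal.span_insert_zero]
  have htf : (b \ {x'}).Finite := hbfin.subset Set.sdiff_subset
  have h2 : (maximalIdeal (R ⧸ Ideal.span {x})).spanFinrank ≤ (b \ {x'}).ncard := by
    rw [hm']
    refine (Submodule.spanFinrank_span_le_ncard_of_finite
      ((htf.image _).image _ |>.image _)).trans ?_
    exact ((Set.ncard_image_le ((htf.image _).image _)).trans
      (Set.ncard_image_le (htf.image _))).trans (Set.ncard_image_le htf)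
  have h3 := Set.ncard_sdiff_singleton_add_one hxb hbfin
  omega

/-- The quotient of a regular local ring by an element of `m \ m ^ 2` is regular, of dimension one
less. -/
theorem IsRegularLocalRing.quotient_span_singleton {R : Type u} [CommRing R] [IsRegularLocalRing R]
    {x : R} (hx : x ∈ maximalIdeal R) (hx2 : x ∉ maximalIdeal R ^ 2) :
    IsRegularLocalRing (R ⧸ Ideal.span {x}) ∧
      ringKrullDim (R ⧸ Ideal.span {x}) + 1 = ringKrullDim R := by
  have hne : Ideal.span {x} ≠ ⊤ := fun h => (maximalIdeal.isMaximal R).ne_top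
    (eq_top_iff.mpr (h ▸ (Ideal.span_singleton_le_iff_mem _).mpr hx))
  have : Nontrivial (R ⧸ Ideal.span {x}) := Ideal.Quotient.nontrivial_iff.mpr hne
  have : IsLocalRing (R ⧸ Ideal.span {x}) :=
    IsLocalRing.of_surjective' (Ideal.Quotient.mk _) Ideal.Quotient.mk_surjective
  have h1 := IsLocalRing.spanFinrank_maximalIdeal_quotient_lt hx hx2
  have h2 : ringKrullDim R ≤ ringKrullDim (R ⧸ Ideal.span {x}) + 1 := by
    have h7 := ringKrullDim_le_ringKrullDim_quotient_add_card (R := R) (s := {x}) (by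
      rw [IsLocalRing.ringJacobson_eq_maximalIdeal]; simpa using hx)
    rwa [Finset.coe_singleton, Finset.card_singleton, Nat.cast_one] at h7
  have h3 := ringKrullDim_le_spanFinrank_maximalIdeal (R ⧸ Ideal.span {x})
  have h4 := (isRegularLocalRing_iff R).mp inferInstance
  have h5 : ringKrullDim (R ⧸ Ideal.span {x}) + 1 ≤
      ((maximalIdeal (R ⧸ Ideal.span {x})).spanFinrank + 1 : ℕ) := by
    push_cast; gcongr
  have h6 : (((maximalIdeal (R ⧸ Ideal.span {x})).spanFinrank + 1 : ℕ) : WithBot ℕ∞) ≤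
    ringKrullDim R := by rw [← h4]; exact_mod_cast h1
  -- With e the minimal number of generators of the maximal ideal, dim R/x + 1 ≤ e(R/x) + 1 ≤ e(R) =
  -- dim R ≤ dim R/x + 1, so equality holds throughout.
  refine ⟨.of_spanFinrank_maximalIdeal_le _ ?_, le_antisymm (h5.trans h6) h2⟩
  have h7 := h6.trans h2
  push_cast at h7
  exact (ENat.WithBot.add_le_add_one_right_iff).mp h7

/-- A regular local ring is a domain. -/
theorem IsRegularLocalRing.isDomain_of_dim (d : ℕ) : ∀ (R : Type u) [CommRing R]
    [IsRegularLocalRing R], ringKrullDim R = d → IsDomain R := by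
  induction d with
  | zero =>
    intro R _ _ hd
    have h4 := (isRegularLocalRing_iff R).mp inferInstance
    rw [hd, spanFinrank_maximalIdeal_eq_finrank_cotangentSpace] at h4
    have h5 : Module.finrank (ResidueField R) (CotangentSpace R) = 0 := by exact_mod_cast h4
    exact (finrank_cotangentSpace_eq_zero_iff.mp h5).isDomain
  | succ d ih =>
    intro R _ _ hd
    obtain ⟨x, hxm, hx2, hxq⟩ : ∃ x ∈ maximalIdeal R, x ∉ maximalIdeal R ^ 2 ∧
        ∀ q ∈ minimalPrimes R, x ∉ q := by
      by_contra! hcon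
      have hsub : ((maximalIdeal R : Ideal R) : Set R) ⊆
          ⋃ i ∈ insert (maximalIdeal R ^ 2) (minimalPrimes R), ((id i : Ideal R) : Set R) := by
        intro x hx
        simp only [Set.mem_iUnion, exists_prop, Set.mem_insert_iff]
        by_cases h : x ∈ maximalIdeal R ^ 2
        · exact ⟨_, Or.inl rfl, h⟩
        · obtain ⟨q, hq, hxq⟩ := hcon x hx h
          exact ⟨q, Or.inr hq, hxq⟩
      -- Prime avoidance tolerates two non-prime members of the family; both places are given to
      -- m^2.
      rw [Ideal.subset_union_prime_finite ((minimalPrimes.finite_of_isNoetherianRing R).insert _)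
        (maximalIdeal R ^ 2) (maximalIdeal R ^ 2)] at hsub
      · obtain ⟨i, hi, hle⟩ := hsub
        rcases Set.mem_insert_iff.mp hi with rfl | hi
        · have h5 : IsField R := by
            rw [← subsingleton_cotangentSpace_iff, Ideal.cotangent_subsingleton_iff]
            exact (pow_two _).symm.trans (le_antisymm (Ideal.pow_le_self two_ne_zero) hle)
          rw [ringKrullDim_eq_zero_of_isField h5] at hd
          exact absurd hd (by norm_cast)
        · have := maximalIdeal_height_eq_ringKrullDim (R := R)
          have h6 : maximalIdeal R = i := (maximalIdeal.isMaximal R).eq_of_le hi.1.1.ne_top hle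
          have h7 : (maximalIdeal R).height = 0 := by
            rw [Ideal.height_eq_zero_iff, h6]; exact hi
          rw [h7, hd] at this
          exact absurd this (by norm_cast)
      · intro i hi h1 _
        exact ((Set.mem_insert_iff.mp hi).resolve_left h1).1.1
    obtain ⟨hreg, hdim⟩ := quotient_span_singleton hxm hx2
    have hd' : ringKrullDim (R ⧸ Ideal.span {x}) = d := by
      rw [hd] at hdim
      push_cast at hdim
      exact le_antisymm (ENat.WithBot.add_le_add_one_right_iff.mp hdim.le)
        (ENat.WithBot.add_le_add_one_right_iff.mp hdim.ge)
    have := ih (R ⧸ Ideal.span {x}) hd'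
    have hprime : (Ideal.span {x}).IsPrime := (Ideal.Quotient.isDomain_iff_prime _).mp this
    obtain ⟨q, hq, hqx⟩ := Ideal.exists_minimalPrimes_le (I := ⊥) (J := Ideal.span {x}) bot_le
    have hqbot : q = ⊥ := by
      -- The minimal prime q lies in the prime (x) but does not contain x, so y = zx ∈ q forces z ∈
      -- q. Thus q = xq, and q = 0 by Nakayama.
      apply Submodule.eq_bot_of_le_smul_of_le_jacobson_bot (Ideal.span {x}) _
        (IsNoetherian.noetherian q)
      · intro y hy
        obtain ⟨z, rfl⟩ := Ideal.mem_span_singleton'.mp (hqx hy)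
        have := (hq.1.1.mem_or_mem hy).resolve_right (hxq q hq)
        rw [mul_comm]
        exact Ideal.mul_mem_mul (Ideal.mem_span_singleton_self x) this
      · rw [jacobson_eq_maximalIdeal _ bot_ne_top]
        exact (Ideal.span_singleton_le_iff_mem _).mpr hxm
    have := hq.1.1
    rw [hqbot] at this
    exact (IsDomain.of_bot_isPrime R)

instance (priority := low) IsRegularLocalRing.isDomain (R : Type u) [CommRing R]
    [IsRegularLocalRing R] : IsDomain R :=
  isDomain_of_dim _ R ((isRegularLocalRing_iff R).mp inferInstance).symm

end RegularLocal

/-! ### Kunz's theorem: freeness of a regular local ring over itself through a power map. -/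

section Frobenius

open IsLocalRing Pointwise

theorem Module.Projective.of_exact {R M N P : Type*} [Ring R] [AddCommGroup M] [AddCommGroup N]
    [AddCommGroup P] [Module R M] [Module R N] [Module R P] {f : M →ₗ[R] N} {g : N →ₗ[R] P}
    (hf : Function.Injective f) (h : Function.Exact f g) (hg : Function.Surjective g)
    [Module.Projective R M] [Module.Projective R P] : Module.Projective R N := by
  obtain ⟨s, hs⟩ := Module.projective_lifting_property g LinearMap.id hg
  have hs' : ∀ x, g (s x) = x := fun x => LinearMap.congr_fun hs x
  refine .of_equiv' (LinearEquiv.ofBijective (f.coprod s) ⟨?_, fun n => ?_⟩)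
  · rw [← LinearMap.ker_eq_bot, LinearMap.ker_eq_bot']
    rintro ⟨a, b⟩ hab
    rw [LinearMap.coprod_apply] at hab
    have h1 := congrArg g hab
    rw [map_add, h.apply_apply_eq_zero, hs', zero_add, map_zero] at h1
    subst h1
    rw [map_zero, add_zero] at hab
    have h2 : a = 0 := hf (hab.trans (map_zero f).symm)
    rw [h2, Prod.mk_zero_zero]
  · obtain ⟨m, hm⟩ := (h (n - s (g n))).mp (by rw [map_sub, hs', sub_self])
    exact ⟨(m, g n), by rw [LinearMap.coprod_apply, hm, sub_add_cancel]⟩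

/-- The map g^i identifies Q/gQ with the kernel of Q/g^{i+1}Q → Q/g^iQ, the hypothesis `h` being the
injectivity. The quotients are thus successive extensions of projective modules. For g^n = 0 the
conclusion reaches Q itself. -/
theorem Module.Projective.quotient_range_pow {R Q : Type*} [Ring R] [AddCommGroup Q] [Module R Q]
    (g : Q →ₗ[R] Q) (n : ℕ)
    (h : ∀ i < n, ∀ q, (g ^ i) q ∈ LinearMap.range (g ^ (i + 1)) → q ∈ LinearMap.range g)
    [Module.Projective R (Q ⧸ LinearMap.range g)] :
    ∀ i ≤ n, Module.Projective R (Q ⧸ LinearMap.range (g ^ i)) := by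
  intro i
  induction i with
  | zero =>
    intro _
    have : Subsingleton (Q ⧸ LinearMap.range (g ^ 0)) := by
      rw [pow_zero, Submodule.Quotient.subsingleton_iff]
      exact LinearMap.range_id
    infer_instance
  | succ i ih =>
    intro hi
    have := ih (by omega)
    have hle : LinearMap.range (g ^ (i + 1)) ≤ LinearMap.range (g ^ i) := by
      rintro _ ⟨q, rfl⟩
      exact ⟨g q, by rw [pow_succ]; rfl⟩
    have hmap : LinearMap.range g ≤ (LinearMap.range (g ^ (i + 1))).comap (g ^ i) := by
      rintro _ ⟨q, rfl⟩
      exact ⟨q, by rw [pow_succ]; rfl⟩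
    refine .of_exact (f := Submodule.mapQ _ _ (g ^ i) hmap) (g := Submodule.factor hle) ?_ ?_
      (Submodule.factor_surjective hle)
    · rw [← LinearMap.ker_eq_bot]
      exact Submodule.ker_liftQ_eq_bot _ _ _ fun q hq => h i (by omega) q
        ((Submodule.Quotient.mk_eq_zero _).mp hq)
    · intro q
      obtain ⟨q, rfl⟩ := Submodule.mkQ_surjective _ q
      constructor
      · intro hq
        obtain ⟨q', rfl⟩ := (Submodule.Quotient.mk_eq_zero _).mp hq
        exact ⟨Submodule.Quotient.mk q', rfl⟩
      · rintro ⟨q', hq'⟩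
        obtain ⟨q', rfl⟩ := Submodule.mkQ_surjective _ q'
        rw [← hq']
        exact (Submodule.Quotient.mk_eq_zero _).mpr ⟨q', rfl⟩

/-- Let the domain `S` be an algebra over `R`, and `y ∈ S` a non-zero element with `y ^ n = x`. If
`S ⧸ y` is projective over `R ⧸ x`, then so is `S ⧸ x`. -/
theorem Module.Projective.quotSMulTop_of_pow {R S : Type u} [CommRing R] [CommRing S] [IsDomain S]
    [Algebra R S] (x : R) (y : S) (n : ℕ) (hy : y ≠ 0) (hxy : algebraMap R S x = y ^ n)
    [Algebra (R ⧸ Ideal.span {x}) (S ⧸ Ideal.span {y})]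
    [IsScalarTower R (R ⧸ Ideal.span {x}) (S ⧸ Ideal.span {y})] (hn : n ≠ 0)
    [Module.Projective (R ⧸ Ideal.span {x}) (S ⧸ Ideal.span {y})] :
    Module.Projective (R ⧸ Ideal.span {x}) (QuotSMulTop x S) := by
  have hmem : ∀ s : S, s ∈ x • (⊤ : Submodule R S) ↔ y ^ n ∣ s := by
    intro s
    rw [Submodule.mem_smul_pointwise_iff_exists]
    simp only [Submodule.mem_top, true_and, Algebra.smul_def, hxy]
    exact ⟨fun ⟨b, hb⟩ => ⟨b, hb.symm⟩, fun ⟨b, hb⟩ => ⟨b, hb.symm⟩⟩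
  have hsurj : Function.Surjective (algebraMap R (R ⧸ Ideal.span {x})) :=
    Ideal.Quotient.mk_surjective
  -- Multiplication by y on S/xS = S/y^nS; its powers give the y-adic filtration, with all graded
  -- pieces isomorphic to S/y.
  obtain ⟨g, hg1⟩ : ∃ g : QuotSMulTop x S →ₗ[R ⧸ Ideal.span {x}] QuotSMulTop x S,
      ∀ s : S, g (Submodule.Quotient.mk s) = Submodule.Quotient.mk (y * s) :=
    ⟨LinearMap.extendScalarsOfSurjective hsurj (QuotSMulTop.map x (LinearMap.mulLeft R y)),
      fun _ => rfl⟩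
  have hg : ∀ (i : ℕ) (s : S),
      (g ^ i) (Submodule.Quotient.mk s) = Submodule.Quotient.mk (y ^ i * s) := by
    intro i
    induction i with
    | zero => intro s; simp
    | succ i ih =>
      intro s
      rw [pow_succ', pow_succ', mul_assoc, Module.End.mul_apply, ih, hg1]
  have hrange : ∀ (i : ℕ), i ≤ n → ∀ (s : S),
      (Submodule.Quotient.mk s : QuotSMulTop x S) ∈ LinearMap.range (g ^ i) ↔ y ^ i ∣ s := by
    intro i hi s
    constructor
    · rintro ⟨q, hq⟩
      obtain ⟨q, rfl⟩ := Submodule.mkQ_surjective _ q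
      rw [Submodule.mkQ_apply, hg, Submodule.Quotient.eq, hmem] at hq
      have h1 : y ^ i ∣ y ^ i * q - s := (pow_dvd_pow y hi).trans hq
      exact (dvd_sub_right (Dvd.intro _ rfl)).mp h1
    · rintro ⟨q, rfl⟩
      exact ⟨Submodule.Quotient.mk q, hg i q⟩
  have hrange1 : ∀ s : S,
      (Submodule.Quotient.mk s : QuotSMulTop x S) ∈ LinearMap.range g ↔ y ∣ s := by
    intro s
    have := hrange 1 (by omega) s
    rwa [pow_one, pow_one] at this
  let f₀ : S →ₗ[R] S ⧸ Ideal.span {y} := (IsScalarTower.toAlgHom R S _).toLinearMap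
  have hf₀ : ∀ s : S, f₀ s = 0 ↔ y ∣ s := fun s => by
    rw [← Ideal.mem_span_singleton, ← Ideal.Quotient.eq_zero_iff_mem]; rfl
  let f : QuotSMulTop x S →ₗ[R ⧸ Ideal.span {x}] S ⧸ Ideal.span {y} :=
    LinearMap.extendScalarsOfSurjective hsurj (Submodule.liftQ _ f₀ fun s hs =>
      (hf₀ s).mpr ((dvd_pow_self y hn).trans ((hmem s).mp hs)))
  have hker : LinearMap.ker f = LinearMap.range g := by
    ext q
    obtain ⟨q, rfl⟩ := Submodule.mkQ_surjective _ q
    exact (hf₀ q).trans (hrange1 q).symm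
  have : Module.Projective (R ⧸ Ideal.span {x}) (QuotSMulTop x S ⧸ LinearMap.range g) :=
    .of_equiv' ((Submodule.quotEquivOfEq _ _ hker.symm).trans (f.quotKerEquivOfSurjective (by
      intro s
      obtain ⟨s, rfl⟩ := Ideal.Quotient.mk_surjective s
      exact ⟨Submodule.Quotient.mk s, rfl⟩))).symm
  have key := Module.Projective.quotient_range_pow g n (by
    intro i hi q hq
    obtain ⟨q, rfl⟩ := Submodule.mkQ_surjective _ q
    rw [Submodule.mkQ_apply, hg] at hq
    have h1 := (hrange (i + 1) hi _).mp hq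
    rw [pow_succ] at h1
    exact (hrange1 q).mpr ((mul_dvd_mul_iff_left (pow_ne_zero i hy)).mp h1)) n le_rfl
  have hzero : g ^ n = 0 := LinearMap.ext fun q => by
    obtain ⟨q, rfl⟩ := Submodule.mkQ_surjective _ q
    exact (hg n q).trans ((Submodule.Quotient.mk_eq_zero _).mpr ((hmem _).mpr (Dvd.intro _ rfl)))
  have hbot : LinearMap.range (g ^ n) = ⊥ := LinearMap.range_eq_bot.mpr hzero
  have e := Submodule.quotEquivOfEqBot _ hbot
  exact .of_equiv' e

/-- Induction on the dimension, cutting by x ∈ m \ m^2 in R and by y = e(x) in S. The pair (R/x,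
S/y) satisfies the same hypotheses, so S/y is free over R/x; the y-adic filtration carries this to
S/xS = S/y^nS, and freeness then lifts along x. Keeping S as a separate copy of R separates the two
roles of the ring and is stable under these quotients. -/
theorem IsRegularLocalRing.free_of_algebraMap_eq_pow_of_dim (n : ℕ) (hn : n ≠ 0) (d : ℕ) :
    ∀ (R S : Type u) [CommRing R] [IsRegularLocalRing R] [CommRing S] [Algebra R S]
      [Module.Finite R S] (e : R ≃+* S), (∀ x, algebraMap R S x = e x ^ n) →
      ringKrullDim R = d → Module.Free R S := by
  induction d with
  | zero =>
    intro R S _ _ _ _ _ e he hd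
    have h4 := (isRegularLocalRing_iff R).mp inferInstance
    rw [hd, spanFinrank_maximalIdeal_eq_finrank_cotangentSpace] at h4
    have h5 : Module.finrank (ResidueField R) (CotangentSpace R) = 0 := by exact_mod_cast h4
    let := (finrank_cotangentSpace_eq_zero_iff.mp h5).toField
    exact Module.Free.of_divisionRing R S
  | succ d ih =>
    intro R S _ _ _ _ _ e he hd
    obtain ⟨x, hxm, hx2⟩ : ∃ x ∈ maximalIdeal R, x ∉ maximalIdeal R ^ 2 := by
      by_contra! hcon
      have h5 : IsField R := by
        rw [← subsingleton_cotangentSpace_iff, Ideal.cotangent_subsingleton_iff]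
        exact (pow_two _).symm.trans (le_antisymm (Ideal.pow_le_self two_ne_zero) hcon)
      rw [ringKrullDim_eq_zero_of_isField h5] at hd
      exact absurd hd (by norm_cast)
    obtain ⟨hreg, hdim⟩ := quotient_span_singleton hxm hx2
    have hd' : ringKrullDim (R ⧸ Ideal.span {x}) = d := by
      rw [hd] at hdim
      push_cast at hdim
      exact le_antisymm (ENat.WithBot.add_le_add_one_right_iff.mp hdim.le)
        (ENat.WithBot.add_le_add_one_right_iff.mp hdim.ge)
    have : IsDomain S := (e.symm : S ≃* R).isDomain
    have hx0 : x ≠ 0 := fun h => hx2 (h ▸ Ideal.zero_mem _)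
    have hy0 : e x ≠ 0 := (map_ne_zero_iff e e.injective).mpr hx0
    let : Algebra (R ⧸ Ideal.span {x}) (S ⧸ Ideal.span {e x}) :=
      (Ideal.quotientMap (Ideal.span {e x}) (algebraMap R S) (by
        rw [Ideal.span_singleton_le_iff_mem, Ideal.mem_comap, he, Ideal.mem_span_singleton]
        exact dvd_pow_self _ hn)).toAlgebra
    have : IsScalarTower R (R ⧸ Ideal.span {x}) (S ⧸ Ideal.span {e x}) :=
      .of_algebraMap_eq' rfl
    have : Module.Finite (R ⧸ Ideal.span {x}) (S ⧸ Ideal.span {e x}) :=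
      Module.Finite.of_restrictScalars_finite R _ _
    have hfree := ih (R ⧸ Ideal.span {x}) (S ⧸ Ideal.span {e x})
      (Ideal.quotientEquiv _ _ e (by rw [Ideal.map_span, Set.image_singleton]; rfl)) (by
        intro r
        obtain ⟨r, rfl⟩ := Ideal.Quotient.mk_surjective r
        rw [Ideal.quotientEquiv_mk, ← map_pow]
        exact congrArg _ (he r)) hd'
    have hproj := Module.Projective.quotSMulTop_of_pow x (e x) n hy0 (he x) hn
    have : Module.Finite (R ⧸ Ideal.span {x}) (QuotSMulTop x S) :=
      Module.Finite.of_restrictScalars_finite R _ _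
    have hfreeQ : Module.Free (R ⧸ Ideal.span {x}) (QuotSMulTop x S) :=
      Module.free_of_flat_of_isLocalRing
    have : Module.FinitePresentation R S := Module.finitePresentation_of_finite R S
    -- Freeness modulo x lifts to S because x lies in the Jacobson radical of R and acts injectively
    -- on S.
    refine (Module.free_quotSMulTop_iff_free R S (x := x) ?_ ?_).mp hfreeQ
    · rwa [jacobson_eq_maximalIdeal _ bot_ne_top]
    · intro a b hab
      simp only [Algebra.smul_def, he] at hab
      exact mul_left_cancel₀ (pow_ne_zero n hy0) hab

/-- If `R` is a regular local ring with `n`-th power map additive and finite, then `R` is free over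
itself through this map. -/
theorem IsRegularLocalRing.free_of_algebraMap_eq_pow {n : ℕ} (hn : n ≠ 0) {R S : Type u}
    [CommRing R] [IsRegularLocalRing R] [CommRing S] [Algebra R S] [Module.Finite R S]
    (e : R ≃+* S) (he : ∀ x, algebraMap R S x = e x ^ n) : Module.Free R S :=
  free_of_algebraMap_eq_pow_of_dim n hn _ R S e he
    ((isRegularLocalRing_iff R).mp inferInstance).symm

end Frobenius

/-! ### Freeness through a lift of Frobenius. -/

section FrobeniusLift

open IsLocalRing Pointwise

/-- For a lift of Frobenius `φ` on a local ring of residue characteristic `p` in which `p` is a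
non-zero-divisor, `p` is not in the square of the maximal ideal. -/
theorem IsLocalRing.natCast_notMem_maximalIdeal_sq {p : ℕ} [Fact p.Prime] {A : Type u} [CommRing A]
    [IsLocalRing A] (φ : A →+* A) (hφ : ∀ a, (p : A) ∣ φ a - a ^ p)
    (htf : (p : A) ∈ nonZeroDivisors A) (hp : (p : A) ∈ maximalIdeal A) :
    (p : A) ∉ maximalIdeal A ^ 2 := by
  have hp0 : p ≠ 0 := (Fact.out : p.Prime).ne_zero
  have hp1 : 1 < p := (Fact.out : p.Prime).one_lt
  intro h
  -- The p-derivation δ(x) = (φ(x) - x^p)/p maps m^2 into m: the product formula has every term in m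
  -- when both factors are, and the correction term of δ(x + y) is a multiple of xy.
  have key : ∀ x ∈ maximalIdeal A ^ 2, x ∈ maximalIdeal A ∧
      ∃ d ∈ maximalIdeal A, φ x = x ^ p + p * d := by
    intro x hx
    rw [pow_two] at hx
    refine Submodule.mul_induction_on hx ?_ ?_
    · intro a ha b hb
      obtain ⟨α, hα⟩ := hφ a
      obtain ⟨β, hβ⟩ := hφ b
      refine ⟨Ideal.mul_mem_left _ _ hb, α * b ^ p + a ^ p * β + p * (α * β), ?_, ?_⟩
      · exact add_mem (add_mem (Ideal.mul_mem_left _ _ (Ideal.pow_mem_of_mem _ hb _ (by omega)))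
          (Ideal.mul_mem_right _ _ (Ideal.pow_mem_of_mem _ ha _ (by omega))))
          (Ideal.mul_mem_right _ _ hp)
      · rw [map_mul, sub_eq_iff_eq_add.mp hα, sub_eq_iff_eq_add.mp hβ]
        ring
    · rintro x y ⟨hx, d, hd, hxd⟩ ⟨hy, e, he, hye⟩
      obtain ⟨r, hr⟩ := exists_add_pow_prime_eq (Fact.out : p.Prime) x y
      refine ⟨add_mem hx hy, d + e - x * y * r, ?_, ?_⟩
      · exact sub_mem (add_mem hd he) (Ideal.mul_mem_right _ _ (Ideal.mul_mem_right _ _ hx))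
      · rw [map_add, hxd, hye, hr]
        ring
  obtain ⟨-, d, hd, h1⟩ := key _ h
  -- Since φ(p) = p, one has δ(p) = 1 - p^{p-1}, which is not in m.
  rw [map_natCast, show (p : A) ^ p = p * p ^ (p - 1) by rw [← pow_succ']; congr 1; omega,
    ← mul_add] at h1
  have h2 : (1 : A) = p ^ (p - 1) + d :=
    (mul_cancel_left_mem_nonZeroDivisors htf).mp (by rw [mul_one]; exact h1)
  exact (maximalIdeal.isMaximal A).ne_top ((Ideal.eq_top_iff_one _).mpr (h2 ▸
    add_mem (Ideal.pow_mem_of_mem _ hp _ (by omega)) hd))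

/-- A regular local ring of residue characteristic `p` in which `p` is a non-zero-divisor is free
over itself through a finite lift of Frobenius. -/
theorem IsRegularLocalRing.free_of_frobenius_lift {p : ℕ} [Fact p.Prime] {A S : Type u} [CommRing A]
    [IsRegularLocalRing A] [CommRing S] [Algebra A S] [Module.Finite A S] (e : A ≃+* S)
    (he : ∀ a, (p : S) ∣ algebraMap A S a - e a ^ p)
    (htf : (p : A) ∈ nonZeroDivisors A) (hp : (p : A) ∈ maximalIdeal A) : Module.Free A S := by
  have hp2 : (p : A) ∉ maximalIdeal A ^ 2 :=
    IsLocalRing.natCast_notMem_maximalIdeal_sq ((e.symm : S →+* A).comp (algebraMap A S))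
      (fun a => by
        obtain ⟨c, hc⟩ := he a
        refine ⟨e.symm c, e.injective ?_⟩
        simpa using hc) htf hp
  have := (IsRegularLocalRing.quotient_span_singleton hp hp2).1
  let : Algebra (A ⧸ Ideal.span {(p : A)}) (S ⧸ Ideal.span {(p : S)}) :=
    (Ideal.quotientMap (Ideal.span {(p : S)}) (algebraMap A S) (by
      rw [Ideal.span_singleton_le_iff_mem, Ideal.mem_comap, map_natCast]
      exact Ideal.mem_span_singleton_self _)).toAlgebra
  have : IsScalarTower A (A ⧸ Ideal.span {(p : A)}) (S ⧸ Ideal.span {(p : S)}) :=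
    .of_algebraMap_eq' rfl
  have : Module.Finite (A ⧸ Ideal.span {(p : A)}) (S ⧸ Ideal.span {(p : S)}) :=
    Module.Finite.of_restrictScalars_finite A _ _
  -- Modulo p the structure map becomes the p-th power map, so Kunz's theorem applies to the regular
  -- ring A/p.
  have hfree : Module.Free (A ⧸ Ideal.span {(p : A)}) (S ⧸ Ideal.span {(p : S)}) :=
    IsRegularLocalRing.free_of_algebraMap_eq_pow (Fact.out : p.Prime).ne_zero
      (Ideal.quotientEquiv _ _ e (by simp [Ideal.map_span])) (by
        intro r
        obtain ⟨r, rfl⟩ := Ideal.Quotient.mk_surjective r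
        rw [Ideal.quotientEquiv_mk, ← map_pow]
        exact (Ideal.Quotient.mk_eq_mk_iff_sub_mem _ _).mpr (Ideal.mem_span_singleton.mpr (he r)))
  have hspan : (p : A) • (⊤ : Submodule A S) = (Ideal.span {(p : S)}).restrictScalars A := by
    ext s
    rw [Submodule.mem_smul_pointwise_iff_exists, Submodule.restrictScalars_mem,
      Ideal.mem_span_singleton]
    simp only [Submodule.mem_top, true_and, Algebra.smul_def, map_natCast]
    exact ⟨fun ⟨b, hb⟩ => ⟨b, hb.symm⟩, fun ⟨b, hb⟩ => ⟨b, hb.symm⟩⟩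
  have E : QuotSMulTop (p : A) S ≃ₗ[A ⧸ Ideal.span {(p : A)}] S ⧸ Ideal.span {(p : S)} :=
    LinearEquiv.extendScalarsOfSurjective (Ideal.Quotient.mk_surjective :
        Function.Surjective (algebraMap A (A ⧸ Ideal.span {(p : A)})))
      ((Submodule.quotEquivOfEq _ _ hspan).trans (Submodule.Quotient.restrictScalarsEquiv A _))
  have : Module.FinitePresentation A S := Module.finitePresentation_of_finite A S
  have : IsDomain S := (e.symm : S ≃* A).isDomain
  have hpS : (p : S) ∈ nonZeroDivisors S := by
    rw [← map_natCast e]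
    exact map_mem_nonZeroDivisors e e.injective htf
  refine (Module.free_quotSMulTop_iff_free A S (x := (p : A)) ?_ ?_).mp (.of_equiv E.symm)
  · rwa [jacobson_eq_maximalIdeal _ bot_ne_top]
  · intro a b hab
    simp only [Algebra.smul_def, map_natCast] at hab
    exact (mul_cancel_left_mem_nonZeroDivisors hpS).mp hab

end FrobeniusLift

/-! ### The duality map of φ. -/

noncomputable section

namespace WittDual

variable {p : ℕ} {A : Type u} [CommRing A] (D : DualizingDatum p A)

/-- Duality for φ in degree 0: the map is transposition under the adjunction between restriction and
coextension of scalars, once κ identifies ω with Hom_A(φ_*A, ω). -/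
lemma map_comp_trace_bijective (M : ModuleCat.{u} A) :
    Function.Bijective fun g : M ⟶ D.ω => (ModuleCat.restrictScalars D.φ).map g ≫ trace D := by
  have h : (fun g : M ⟶ D.ω => (ModuleCat.restrictScalars D.φ).map g ≫ trace D) =
      fun g => ((ModuleCat.restrictCoextendScalarsAdj D.φ).homEquiv M D.ω).symm (g ≫ D.κ.hom) := by
    funext g
    rw [Adjunction.homEquiv_counit, Functor.map_comp, Category.assoc]
    rfl
  rw [h]
  exact (Equiv.bijective _).comp ⟨fun a b hab => (cancel_mono _).mp hab,
    fun b => ⟨b ≫ D.κ.inv, by simp⟩⟩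

/-- An exact functor carries the class of an extension to the class of its image, so only the map
out of the left-hand term changes. -/
lemma dualityMap_extClass_comp (f : A →+* A)
    (t : (ModuleCat.restrictScalars f).obj D.ω ⟶ D.ω) {S : ShortComplex (ModuleCat.{u} A)}
    (hS : S.ShortExact) (g : S.X₁ ⟶ D.ω) :
    (dualityMap D f t S.X₃).hom (hS.extClass.comp (Ext.mk₀ g) (add_zero 1) : Ext S.X₃ D.ω 1) =
      ((hS.map_of_exact (ModuleCat.restrictScalars f)).extClass.comp
        (Ext.mk₀ ((ModuleCat.restrictScalars f).map g ≫ t)) (add_zero 1) :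
        Ext ((ModuleCat.restrictScalars f).obj S.X₃) D.ω 1) := by
  change ((hS.extClass.comp (Ext.mk₀ g) (add_zero 1)).mapExactFunctor
    (ModuleCat.restrictScalars f)).comp (Ext.mk₀ t) (add_zero 1) = _
  rw [Ext.mapExactFunctor_comp, Ext.mapExactFunctor_mk₀, Ext.mapExactFunctor_extClass]
  refine (Ext.comp_assoc_of_second_deg_zero _ _ _ _).trans ?_
  rw [Ext.mk₀_comp_mk₀]
  rfl

/-- The duality map is natural in the module. -/
lemma extMap_dualityMap (f : A →+* A) (t : (ModuleCat.restrictScalars f).obj D.ω ⟶ D.ω)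
    {M N : ModuleCat.{u} A} (g : M ⟶ N) (e : Ext N D.ω 1) :
    (extMap D ((ModuleCat.restrictScalars f).map g)).hom ((dualityMap D f t N).hom e) =
      (dualityMap D f t M).hom ((extMap D g).hom e) := by
  change (Ext.mk₀ _).comp ((e.mapExactFunctor (ModuleCat.restrictScalars f)).comp (Ext.mk₀ t)
    (add_zero 1)) (zero_add 1) = (((Ext.mk₀ g).comp e (zero_add 1)).mapExactFunctor
    (ModuleCat.restrictScalars f)).comp (Ext.mk₀ t) (add_zero 1)
  rw [Ext.mapExactFunctor_comp, Ext.mapExactFunctor_mk₀, Ext.comp_assoc_of_third_deg_zero]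

/-- If `f_* A` is free, then `f_*` of any free module is projective. -/
lemma projective_restrictScalars_finsupp (f : A →+* A)
    (h : @Module.Free A A _ _ (Module.compHom A f)) (ι : Type u) :
    Projective ((ModuleCat.restrictScalars f).obj (ModuleCat.of A (ι →₀ A))) := by
  have h2 : @Module.Projective A _ (ι →₀ A) _
      (@Finsupp.module ι A A _ _ (Module.compHom A f)) :=
    @Module.Projective.of_free A _ (ι →₀ A) _ (@Finsupp.module ι A A _ _ (Module.compHom A f))
      (@Module.Free.finsupp A A ι _ _ (Module.compHom A f) h)
  exact @ModuleCat.projective_of_categoryTheory_projective A _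
    ((ModuleCat.restrictScalars f).obj (ModuleCat.of A (ι →₀ A))) h2

/-- The duality map of a finite morphism `φ` with `φ_* A` free is an isomorphism. -/
theorem isIso_duality (h : @Module.Free A A _ _ (Module.compHom A D.φ))
    (M : ModuleCat.{u} A) : IsIso (duality D M) := by
  rw [ConcreteCategory.isIso_iff_bijective]
  -- Let K be the kernel of the free cover F of M. Both F and φ_*F are projective, so the two Ext
  -- groups are the cokernels of Hom(F, ω) → Hom(K, ω) and of its analogue for φ_*. The bijections
  -- `map_comp_trace_bijective` for F and K match these cokernels.
  let F : (M →₀ A) →ₗ[A] M := Finsupp.linearCombination A id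
  have hF : Function.Surjective F := Finsupp.linearCombination_surjective A Function.surjective_id
  let S := F.shortComplexKer
  have hS : S.ShortExact := LinearMap.shortExact_shortComplexKer hF
  have hS' := hS.map_of_exact (ModuleCat.restrictScalars D.φ)
  have hproj : Projective (S.map (ModuleCat.restrictScalars D.φ)).X₂ :=
    projective_restrictScalars_finsupp D.φ h M
  have hproj' : Projective S.X₂ :=
    ModuleCat.projective_of_free (Finsupp.basisSingleOne (R := A) (ι := M))
  constructor
  · rw [injective_iff_map_eq_zero]
    intro (e : Ext S.X₃ D.ω 1) he
    obtain ⟨g, rfl⟩ := Ext.contravariant_sequence_exact₃ hS D.ω e (Ext.eq_zero_of_projective _)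
      (add_zero 1)
    obtain ⟨g, rfl⟩ := (Ext.mk₀_bijective _ _).2 g
    have h1 := (dualityMap_extClass_comp D D.φ (trace D) hS g).symm.trans he
    obtain ⟨k, hk⟩ := Ext.contravariant_sequence_exact₁ hS' D.ω _ (add_zero 1) h1
    obtain ⟨k, rfl⟩ := (Ext.mk₀_bijective _ _).2 k
    obtain ⟨k, rfl⟩ := (map_comp_trace_bijective D S.X₂).2 k
    have h2 := (Ext.mk₀_bijective _ _).1 ((Ext.mk₀_comp_mk₀ _ _).symm.trans hk)
    have h3 : S.f ≫ k = g := (map_comp_trace_bijective D S.X₁).1 (by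
      refine Eq.trans ?_ h2
      simp only [Functor.map_comp, Category.assoc]
      rfl)
    rw [← h3, ← Ext.mk₀_comp_mk₀]
    exact ShortComplex.ShortExact.extClass_comp_assoc _ _
  · intro e
    obtain ⟨g, hg⟩ := Ext.contravariant_sequence_exact₃ hS' D.ω e (Ext.eq_zero_of_projective _)
      (add_zero 1)
    obtain ⟨g, rfl⟩ := (Ext.mk₀_bijective _ _).2 g
    obtain ⟨g, rfl⟩ := (map_comp_trace_bijective D S.X₁).2 g
    exact ⟨hS.extClass.comp (Ext.mk₀ g) (add_zero 1),
      (dualityMap_extClass_comp D D.φ (trace D) hS g).trans hg⟩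

lemma isZero_extDual {M : ModuleCat.{u} A} (h : Limits.IsZero M) : Limits.IsZero (extDual D M) := by
  refine ModuleCat.isZero_iff_subsingleton.mpr ?_
  exact ⟨fun (a b : Ext M D.ω 1) => by
    rw [← Ext.mk₀_id_comp a, ← Ext.mk₀_id_comp b, h.eq_of_src (𝟙 M) 0, Ext.mk₀_zero, Ext.zero_comp,
      Ext.zero_comp]⟩

/-- The duality maps of the modules `W_n(A/p)` are isomorphisms if `A` is a regular local ring. -/
theorem isIso_duality_WMod [hp : Fact p.Prime] [IsRegularLocalRing A] (n : ℕ) :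
    IsIso (duality D (WMod D n)) := by
  by_cases hpm : (p : A) ∈ IsLocalRing.maximalIdeal A
  · refine isIso_duality D ?_ _
    exact @IsRegularLocalRing.free_of_frobenius_lift p _ A A _ _ _ D.φ.toAlgebra D.finite
      (RingEquiv.refl A) (fun a => Ideal.mem_span_singleton.mp (D.lift a)) D.torsionFree hpm
  -- If p is invertible, A/p is the zero ring and both sides of the duality map vanish.
  · have hunit : IsUnit (p : A) := by simpa using hpm
    have h0 : Subsingleton (A ⧸ Ideal.span {(p : A)}) := by
      rw [Ideal.Quotient.subsingleton_iff]
      exact Ideal.span_singleton_eq_top.mpr hunit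
    have h1 : Subsingleton (W p A n) := inferInstanceAs (Subsingleton (Fin n → _))
    have h2 : Limits.IsZero (WMod D n) := @ModuleCat.isZero_of_subsingleton _ _ (WMod D n) h1
    have h3 := isZero_extDual D h2
    have h4 : Limits.IsZero (extDual D ((ModuleCat.restrictScalars D.φ).obj (WMod D n))) :=
      isZero_extDual D (Functor.map_isZero _ h2)
    exact (Functor.map_isZero (ModuleCat.restrictScalars D.φ) h3).isIso h4 _

/-! ### Connecting classes and their functoriality. -/

/-- The class in `Ext^1` of the pushout along `g : S₁ ⟶ ω` of a short exact sequence `S`. -/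
def connecting {S : ShortComplex (ModuleCat.{u} A)} (hS : S.ShortExact) (g : S.X₁ ⟶ D.ω) :
    Ext S.X₃ D.ω 1 :=
  hS.extClass.comp (Ext.mk₀ g) (add_zero 1)

/-- Naturality of the extension class trades pullback along τ₃ for precomposition with τ₁. The duals
of the maps between the A/p^n are computed in this way. -/
lemma extMap_connecting {S₁ S₂ : ShortComplex (ModuleCat.{u} A)} (h₁ : S₁.ShortExact)
    (h₂ : S₂.ShortExact) (f : S₁ ⟶ S₂) (g : S₂.X₁ ⟶ D.ω) :
    (extMap D f.τ₃).hom (connecting D h₂ g) = connecting D h₁ (f.τ₁ ≫ g) := by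
  change (Ext.mk₀ f.τ₃).comp (h₂.extClass.comp (Ext.mk₀ g) (add_zero 1)) (zero_add 1) =
    h₁.extClass.comp (Ext.mk₀ (f.τ₁ ≫ g)) (add_zero 1)
  rw [← Ext.mk₀_comp_mk₀, ← Ext.comp_assoc_of_third_deg_zero,
    ← ShortComplex.ShortExact.extClass_naturality h₁ h₂ f, Ext.comp_assoc_of_third_deg_zero]

lemma extMap_comp_apply {M N P : ModuleCat.{u} A} (f : M ⟶ N) (g : N ⟶ P) (e : Ext P D.ω 1) :
    (extMap D (f ≫ g)).hom e = (extMap D f).hom ((extMap D g).hom e) := by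
  change (Ext.mk₀ (f ≫ g)).comp e (zero_add 1) =
    (Ext.mk₀ f).comp ((Ext.mk₀ g).comp e (zero_add 1)) (zero_add 1)
  rw [Ext.mk₀_comp_mk₀_assoc]

lemma extMap_comp {M N P : ModuleCat.{u} A} (f : M ⟶ N) (g : N ⟶ P) :
    extMap D (f ≫ g) = extMap D g ≫ extMap D f := by
  ext e
  exact extMap_comp_apply D f g e

lemma dualityMap_connecting (f : A →+* A)
    (t : (ModuleCat.restrictScalars f).obj D.ω ⟶ D.ω) {S : ShortComplex (ModuleCat.{u} A)}
    (hS : S.ShortExact) (g : S.X₁ ⟶ D.ω) :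
    (dualityMap D f t S.X₃).hom (connecting D hS g) =
      connecting D (hS.map_of_exact (ModuleCat.restrictScalars f))
        ((ModuleCat.restrictScalars f).map g ≫ t) :=
  dualityMap_extClass_comp D f t hS g

/-! ### The trace on A, and the classes representing λ and u. -/

/-- The trace `φ_* A → A`, obtained from `φ_* ω → ω` by means of `ι : A ≅ ω`. -/
def traceA (a : A) : A := D.ι.inv.hom ((trace D).hom (a • D.ι.hom.hom (1 : A) : D.ω))

lemma iota_inv_iota_hom (w : D.ω) : D.ι.hom.hom (D.ι.inv.hom w) = w :=
  ConcreteCategory.congr_hom D.ι.inv_hom_id w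

lemma traceA_smul_iota (a : A) :
    traceA D a • D.ι.hom.hom (1 : A) = (trace D).hom (a • D.ι.hom.hom (1 : A) : D.ω) := by
  rw [← map_smul, smul_eq_mul, mul_one]
  exact iota_inv_iota_hom D _

lemma trace_map_smul (a : A) (w : D.ω) :
    (trace D).hom (D.φ a • w : D.ω) = a • (trace D).hom w :=
  (trace D).hom.map_smul a w

/-- The projection formula. As φ fixes p, it makes the trace commute with powers of p. -/
lemma traceA_map_mul (a b : A) : traceA D (D.φ a * b) = a * traceA D b := by
  unfold traceA
  rw [mul_smul, trace_map_smul, map_smul, smul_eq_mul]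

lemma traceA_natCast_pow_mul (k : ℕ) (b : A) : traceA D (p ^ k * b) = p ^ k * traceA D b := by
  rw [← traceA_map_mul, map_pow, map_natCast]

lemma iotaMul_apply (a x : A) : (iotaMul D a).hom x = (x * a) • D.ι.hom.hom (1 : A) := by
  change a • D.ι.hom.hom x = _
  rw [← map_smul, ← map_smul, smul_eq_mul, smul_eq_mul, mul_one, mul_comm]

lemma trace_iotaMul_map (a x : A) :
    (trace D).hom ((iotaMul D a).hom (D.φ x)) = (iotaMul D (traceA D a)).hom x := by
  rw [iotaMul_apply, iotaMul_apply, mul_smul, mul_smul, trace_map_smul, traceA_smul_iota]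

lemma iotaMul_mul (a c x : A) : (iotaMul D a).hom (c * x) = (iotaMul D (c * a)).hom x := by
  rw [iotaMul_apply, iotaMul_apply, mul_left_comm, mul_assoc]

lemma traceIter_succ_apply (k : ℕ) (w : D.ω) :
    (traceIter D (k + 1)).hom w = (trace D).hom ((traceIter D k).hom w : D.ω) := rfl

/-- The definition puts the extra trace outermost; dualizing φ : φ^m_* → φ^{m+1}_* requires it
innermost. -/
lemma traceIter_succ_apply' (k : ℕ) (w : D.ω) :
    (traceIter D (k + 1)).hom w = (traceIter D k).hom ((trace D).hom w : D.ω) := by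
  induction k with
  | zero => rfl
  | succ k ih => rw [traceIter_succ_apply, ih, traceIter_succ_apply]

variable [hp : Fact p.Prime]

lemma iota_hom_mk (n : ℕ) (a : A) :
    (iota D n).hom.hom (Ideal.Quotient.mk (Ideal.span {(p : A)} ^ n) a) =
      connecting D (powSeq_shortExact D n) (iotaMul D a) := rfl

/-- The class in `Ext^1(φ^k_* (A/p^n), ω)` which corresponds to `a ∈ A/p^n` by duality. -/
def pushClass (k n : ℕ) (a : A) : Ext ((push D k).obj (QMod p A n)) D.ω 1 :=
  connecting D ((powSeq_shortExact D n).map_of_exact (push D k))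
    ((push D k).map (iotaMul D a) ≫ traceIter D k)

lemma lam_mk (m : ℕ) (a : A) :
    (lam D m).hom (Ideal.Quotient.mk (Ideal.span {(p : A)} ^ (m + 1)) a) =
      (extMap D (ghost D m)).hom (pushClass D m (m + 1) a) :=
  congrArg (extMap D (ghost D m)).hom
    (dualityMap_connecting D (D.φ ^ m) (traceIter D m) (powSeq_shortExact D (m + 1)) _)

/-- `φ` as a map from the sequence `0 → A → A → A/p^n → 0` to its restriction along `φ`. -/
def powSeqFrob (n : ℕ) : powSeq D n ⟶ (powSeq D n).map (ModuleCat.restrictScalars D.φ) where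
  τ₁ := toPush D.φ (M := ModuleCat.of A A) (N := ModuleCat.of A A) D.φ.toAddMonoidHom
    (fun a x => map_mul D.φ a x)
  τ₂ := toPush D.φ (M := ModuleCat.of A A) (N := ModuleCat.of A A) D.φ.toAddMonoidHom
    (fun a x => map_mul D.φ a x)
  τ₃ := frobQ D n
  comm₁₂ := by
    ext
    change (p : A) ^ n * D.φ 1 = D.φ ((p : A) ^ n * 1)
    simp
  comm₂₃ := rfl

/-- The left component of the lift `powSeqFrob` is φ, so the dual class is given by x ↦ tr(φ(x)a ·
ι(1)), that is, by the trace of a. -/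
lemma u_mk (n : ℕ) (a : A) :
    (u D n).hom (Ideal.Quotient.mk (Ideal.span {(p : A)} ^ n) a) =
      Ideal.Quotient.mk (Ideal.span {(p : A)} ^ n) (traceA D a) := by
  have h : (extMap D (frobQ D n)).hom ((duality D (QMod p A n)).hom
      ((iota D n).hom.hom (Ideal.Quotient.mk (Ideal.span {(p : A)} ^ n) a))) =
      (iota D n).hom.hom (Ideal.Quotient.mk (Ideal.span {(p : A)} ^ n) (traceA D a)) := by
    rw [iota_hom_mk, iota_hom_mk]
    refine (congrArg _ (dualityMap_connecting D D.φ (trace D) (powSeq_shortExact D n) _)).trans ?_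
    refine (extMap_connecting D (powSeq_shortExact D n) _ (powSeqFrob D n) _).trans ?_
    congr 1
    ext
    change (trace D).hom ((iotaMul D a).hom (D.φ 1)) = (iotaMul D (traceA D a)).hom (1 : A)
    rw [iotaMul_apply, iotaMul_apply, map_one, one_mul, one_mul, traceA_smul_iota]
  change (iota D n).inv.hom _ = _
  refine (congrArg (iota D n).inv.hom h).trans ?_
  exact ConcreteCategory.congr_hom (iota D n).hom_inv_id _

lemma uIter_mk (n k : ℕ) (a : A) :
    (uIter D n k).hom (Ideal.Quotient.mk (Ideal.span {(p : A)} ^ n) a) =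
      Ideal.Quotient.mk (Ideal.span {(p : A)} ^ n) ((traceA D)^[k] a) := by
  induction k with
  | zero => rfl
  | succ k ih =>
    rw [Function.iterate_succ_apply', ← u_mk, ← ih]
    rfl

/-- The endomorphism of the sequence `0 → A → A → A/p^n → 0` given by multiplication by `c`. -/
def powSeqMul (n : ℕ) (c : A) : powSeq D n ⟶ powSeq D n where
  τ₁ := c • 𝟙 _
  τ₂ := c • 𝟙 _
  τ₃ := c • 𝟙 _

lemma smul_iota_hom (n : ℕ) (c : A) (a : Q p A n) :
    (extMap D (c • 𝟙 (QMod p A n))).hom ((iota D n).hom.hom a) =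
      (iota D n).hom.hom (Ideal.Quotient.mk (Ideal.span {(p : A)} ^ n) c * a) := by
  obtain ⟨a, rfl⟩ := Ideal.Quotient.mk_surjective a
  rw [← map_mul, iota_hom_mk, iota_hom_mk]
  refine (extMap_connecting D (powSeq_shortExact D n) _ (powSeqMul D n c) _).trans ?_
  congr 1
  ext
  change (iotaMul D a).hom (c * 1) = (iotaMul D (c * a)).hom (1 : A)
  rw [iotaMul_apply, iotaMul_apply, mul_one, one_mul]

/-! ### Lifting Witt vectors to W(A), where ghost components can be evaluated. -/

variable (p A) in
/-- The map `W(A) → W_n(A/p)`. -/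
def reduceW (n : ℕ) : WittVector p A →+* W p A n :=
  (WittVector.truncate n).comp (WittVector.map (Ideal.Quotient.mk (Ideal.span {(p : A)})))

variable (p A) in
lemma reduceW_surjective (n : ℕ) : Function.Surjective (reduceW p A n) :=
  (WittVector.truncate_surjective p n _).comp
    (WittVector.map_surjective _ Ideal.Quotient.mk_surjective)

lemma ghostRingHom_reduceW (m : ℕ) (X : WittVector p A) :
    ghostRingHom p A m (reduceW p A (m + 1) X) =
      Ideal.Quotient.mk (Ideal.span {(p : A)} ^ (m + 1)) (ghostComponent m X) := by
  rw [reduceW, RingHom.comp_apply, ghostRingHom_truncate, ghostComponentModPPow_map_mk]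

lemma ghost_reduceW (m : ℕ) (X : WittVector p A) :
    (ghost D m).hom (reduceW p A (m + 1) X) =
      Ideal.Quotient.mk (Ideal.span {(p : A)} ^ (m + 1)) (ghostComponent m X) :=
  ghostRingHom_reduceW m X

lemma res_reduceW (n : ℕ) (X : WittVector p A) :
    (res D n).hom (reduceW p A (n + 1) X) = reduceW p A n X :=
  TruncatedWittVector.truncate_wittVector_truncate (Nat.le_succ n)
    (WittVector.map (Ideal.Quotient.mk (Ideal.span {(p : A)})) X)

lemma ver_reduceW (n : ℕ) (X : WittVector p A) :
    (ver D n).hom (reduceW p A n X) = reduceW p A (n + 1) (verschiebung X) := by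
  refine (verFun_truncate n
    (WittVector.map (Ideal.Quotient.mk (Ideal.span {(p : A)})) X)).trans ?_
  rw [reduceW, RingHom.comp_apply, map_verschiebung]

/-! ### The action of `W_n(A/p)` -/

/-- Since the ghost map is multiplicative, it turns multiplication by x into multiplication by a
lift c of its ghost value. Naturality of the duality map moves c inside to A/p^{m+1}. -/
lemma smul_lam (m : ℕ) (x : W p A (m + 1)) (a : Q p A (m + 1)) :
    x • (lam D m).hom a = (lam D m).hom (ghostRingHom p A m x * a) := by
  obtain ⟨c, hc⟩ := Ideal.Quotient.mk_surjective (ghostRingHom p A m x)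
  have h1 : mulW D (m + 1) x ≫ ghost D m =
      ghost D m ≫ (push D m).map (c • 𝟙 (QMod p A (m + 1))) := by
    ext y
    refine (map_mul (ghostRingHom p A m) x y).trans ?_
    rw [← hc]
    rfl
  change (extMap D (mulW D (m + 1) x)).hom ((extMap D (ghost D m)).hom
    ((dualityIter D m (QMod p A (m + 1))).hom ((iota D (m + 1)).hom.hom a))) =
      (extMap D (ghost D m)).hom ((dualityIter D m (QMod p A (m + 1))).hom
        ((iota D (m + 1)).hom.hom _))
  rw [← extMap_comp_apply, h1, extMap_comp_apply, extMap_dualityMap, smul_iota_hom, hc]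

lemma ghostComponent_iterate_verschiebung_teichmuller (m r : ℕ) (b : A) :
    ghostComponent m (verschiebung^[r] (teichmuller p b)) =
      if r ≤ m then (p : A) ^ r * b ^ p ^ (m - r) else 0 := by
  induction r generalizing m with
  | zero => simp [ghostComponent_teichmuller]
  | succ r ih =>
    rw [Function.iterate_succ_apply']
    cases m with
    | zero => simp [ghostComponent_zero_verschiebung]
    | succ m =>
      rw [ghostComponent_verschiebung, ih]
      simp only [Nat.add_le_add_iff_right, Nat.add_sub_add_right, mul_ite, mul_zero, pow_succ']
      simp only [mul_assoc]

lemma verTeich_mk (m r : ℕ) (b : A) :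
    verTeich m r (Ideal.Quotient.mk (Ideal.span {(p : A)} ^ (m + 1)) b) =
      reduceW p A (m + 1) (verschiebung^[r] (teichmuller p b)) := by
  have h : ∀ r, verschiebung^[r] (teichmuller p (Ideal.Quotient.mk (Ideal.span {(p : A)}) b)) =
      WittVector.map (Ideal.Quotient.mk (Ideal.span {(p : A)}))
        (verschiebung^[r] (teichmuller p b)) := by
    intro r
    induction r with
    | zero => exact (map_teichmuller p _ b).symm
    | succ r ih =>
      rw [Function.iterate_succ_apply', ih, Function.iterate_succ_apply', map_verschiebung]
  exact congrArg (WittVector.truncate (m + 1)) (h r)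

theorem verTeich_smul_lam (m r : ℕ) (a b : Q p A (m + 1)) :
    verTeich m r b • (lam D m).hom a =
      (p : A) ^ r • (lam D m).hom (a * b ^ p ^ (m - r)) := by
  obtain ⟨b, rfl⟩ := Ideal.Quotient.mk_surjective b
  rw [smul_lam, verTeich_mk, ghostRingHom_reduceW, ← Nat.cast_pow, Nat.cast_smul_eq_nsmul]
  refine Eq.trans (congrArg (lam D m).hom ?_) (map_nsmul (lam D m).hom (p ^ r) _)
  rw [ghostComponent_iterate_verschiebung_teichmuller]
  change _ = (p ^ r) • (a * Ideal.Quotient.mk (Ideal.span {(p : A)} ^ (m + 1)) b ^ p ^ (m - r))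
  rw [nsmul_eq_mul, ← map_natCast (Ideal.Quotient.mk (Ideal.span {(p : A)} ^ (m + 1)))]
  split_ifs with h
  · rw [map_mul, map_pow _ b, Nat.cast_pow]
    ring
  -- For r > m the truncated exponent m - r is 0, which is harmless: p^r already vanishes in
  -- A/p^{m+1}.
  · have h0 : Ideal.Quotient.mk (Ideal.span {(p : A)} ^ (m + 1)) ((p ^ r : ℕ) : A) = 0 := by
      rw [Ideal.Quotient.eq_zero_iff_mem, Nat.cast_pow]
      exact Ideal.pow_le_pow_right (by omega)
        (Ideal.pow_mem_pow (Ideal.mem_span_singleton_self _) r)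
    rw [h0, map_zero, zero_mul, zero_mul]

/-! ### Compatibility with `T` -/

/-- The projection from `0 → A → A → A/p^{n+1} → 0` to `0 → A → A → A/p^n → 0`. -/
def powSeqProj (n : ℕ) : powSeq D (n + 1) ⟶ powSeq D n where
  τ₁ := (p : A) • 𝟙 _
  τ₂ := 𝟙 _
  τ₃ := proj p A n
  comm₁₂ := by
    ext
    change (p : A) ^ n * ((p : A) * 1) = (p : A) ^ (n + 1) * 1
    ring
  comm₂₃ := rfl

/-- Multiplication by `p` from `0 → A → A → A/p^n → 0` to `0 → A → A → A/p^{n+1} → 0`. -/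
def powSeqMulP (n : ℕ) : powSeq D n ⟶ powSeq D (n + 1) where
  τ₁ := 𝟙 _
  τ₂ := (p : A) • 𝟙 _
  τ₃ := mulPow p A n 1 (n + 1) rfl
  comm₁₂ := by
    ext
    change (p : A) ^ (n + 1) * 1 = (p : A) * ((p : A) ^ n * 1)
    ring
  comm₂₃ := by
    ext
    change Ideal.Quotient.mk (Ideal.span {(p : A)} ^ (n + 1)) ((p : A) * 1) =
      Ideal.Quotient.mk (Ideal.span {(p : A)} ^ (n + 1)) ((p : A) ^ 1 * 1)
    rw [pow_one]

/-- The map `φ^m_* M → φ^{m+1}_* N` given by a map `g : M → φ_* N`. -/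
def pushToPush (m : ℕ) {M N : ModuleCat.{u} A} (g : M ⟶ (ModuleCat.restrictScalars D.φ).obj N) :
    (push D m).obj M ⟶ (push D (m + 1)).obj N :=
  (push D m).map g ≫ (ModuleCat.restrictScalarsComp'App (D.φ ^ m) D.φ (D.φ ^ (m + 1))
    (pow_succ' D.φ m) N).inv

/-- `φ` as a map from `φ^m_*` to `φ^{m+1}_*` of the sequence `0 → A → A → A/p^n → 0`. -/
def powSeqPush (m n : ℕ) : (powSeq D n).map (push D m) ⟶ (powSeq D n).map (push D (m + 1)) where
  τ₁ := pushToPush D m (powSeqFrob D n).τ₁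
  τ₂ := pushToPush D m (powSeqFrob D n).τ₂
  τ₃ := pushToPush D m (powSeqFrob D n).τ₃
  comm₁₂ := by
    ext x
    exact congrArg (fun f => f.hom x) (powSeqFrob D n).comm₁₂
  comm₂₃ := by
    ext x
    exact congrArg (fun f => f.hom x) (powSeqFrob D n).comm₂₃

/-- From φ(x) ≡ x^p mod p follows φ(x)^{p^k} ≡ x^{p^{k+1}} mod p^{k+1}; with k = m - i this handles
the i-th term. The last term of the longer ghost component carries the factor p^{m+1}. -/
lemma dvd_map_ghostComponent_sub (m : ℕ) (X : WittVector p A) :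
    (p : A) ^ (m + 1) ∣ D.φ (ghostComponent m X) - ghostComponent (m + 1) X := by
  rw [ghostComponent_apply, ghostComponent_apply, aeval_wittPolynomial, aeval_wittPolynomial,
    Finset.sum_range_succ _ (m + 1), map_sum, ← sub_sub, ← Finset.sum_sub_distrib]
  refine dvd_sub (Finset.dvd_sum fun i hi => ?_) (Dvd.intro _ rfl)
  have hi' : i ≤ m := Nat.lt_succ_iff.mp (Finset.mem_range.mp hi)
  rw [map_mul, map_pow, map_pow, map_natCast, ← mul_sub,
    show m + 1 - i = (m - i) + 1 by omega, pow_succ' p, pow_mul,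
    show (p : A) ^ (m + 1) = (p : A) ^ i * (p : A) ^ (m - i + 1) by
      rw [← pow_add]; congr 1; omega]
  exact mul_dvd_mul_left _
    (dvd_sub_pow_of_dvd_sub (Ideal.mem_span_singleton.mp (D.lift _)) (m - i))

lemma ghost_comp_proj (m : ℕ) :
    ghost D (m + 1) ≫ (push D (m + 1)).map (proj p A (m + 1)) =
      res D (m + 1) ≫ ghost D m ≫ pushToPush D m (frobQ D (m + 1)) := by
  ext x
  obtain ⟨X, rfl⟩ := reduceW_surjective p A (m + 2) x
  change (proj p A (m + 1)).hom ((ghost D (m + 1)).hom (reduceW p A (m + 2) X)) =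
    (frobQ D (m + 1)).hom ((ghost D m).hom ((res D (m + 1)).hom (reduceW p A (m + 2) X)))
  rw [res_reduceW, ghost_reduceW, ghost_reduceW]
  change Ideal.Quotient.mk (Ideal.span {(p : A)} ^ (m + 1)) _ =
    Ideal.Quotient.mk (Ideal.span {(p : A)} ^ (m + 1)) (D.φ _)
  refine ((Ideal.Quotient.mk_eq_mk_iff_sub_mem _ _).mpr ?_).symm
  rw [Ideal.span_singleton_pow, Ideal.mem_span_singleton]
  exact dvd_map_ghostComponent_sub D m X

set_option linter.unusedSectionVars false in
lemma powSeqPush_comp_traceIter (m n : ℕ) (a : A) :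
    (powSeqPush D m n).τ₁ ≫ (push D (m + 1)).map (iotaMul D a) ≫ traceIter D (m + 1) =
      (push D m).map (iotaMul D (traceA D a)) ≫ traceIter D m := by
  ext x
  change (traceIter D (m + 1)).hom ((iotaMul D a).hom (D.φ x)) =
    (traceIter D m).hom ((iotaMul D (traceA D a)).hom x)
  rw [traceIter_succ_apply']
  exact congrArg (traceIter D m).hom (trace_iotaMul_map D a x)

/-- The left component of `powSeqProj` is multiplication by p, which is absorbed into a. -/
lemma extMap_proj_pushClass (k n : ℕ) (a : A) :
    (extMap D ((push D k).map (proj p A n))).hom (pushClass D k n a) =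
      pushClass D k (n + 1) (p * a) := by
  refine (extMap_connecting D ((powSeq_shortExact D (n + 1)).map_of_exact (push D k))
    ((powSeq_shortExact D n).map_of_exact (push D k))
    ((push D k).mapShortComplex.map (powSeqProj D n)) _).trans ?_
  refine congrArg (connecting D ((powSeq_shortExact D (n + 1)).map_of_exact (push D k))) ?_
  ext x
  exact congrArg (traceIter D k).hom (iotaMul_mul D a p x)

lemma extMap_frobQ_pushClass (k n : ℕ) (a : A) :
    (extMap D (pushToPush D k (frobQ D n))).hom (pushClass D (k + 1) n a) =
      pushClass D k n (traceA D a) := by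
  refine (extMap_connecting D ((powSeq_shortExact D n).map_of_exact (push D k))
    ((powSeq_shortExact D n).map_of_exact (push D (k + 1))) (powSeqPush D k n) _).trans ?_
  exact congrArg (connecting D ((powSeq_shortExact D n).map_of_exact (push D k)))
    (powSeqPush_comp_traceIter D k n a)

theorem lam_mul_p (m : ℕ) (a : Q p A (m + 1)) :
    (lam D (m + 1)).hom ((mulPow p A (m + 1) 1 (m + 2) rfl).hom a) =
      (T D (m + 1)).hom ((lam D m).hom ((WittDual.u D (m + 1)).hom a)) := by
  obtain ⟨a, rfl⟩ := Ideal.Quotient.mk_surjective a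
  have h1 : (mulPow p A (m + 1) 1 (m + 2) rfl).hom
      (Ideal.Quotient.mk (Ideal.span {(p : A)} ^ (m + 1)) a) =
        Ideal.Quotient.mk (Ideal.span {(p : A)} ^ (m + 2)) (p * a) :=
    congrArg (fun c : A => Ideal.Quotient.mk (Ideal.span {(p : A)} ^ (m + 2)) (c * a))
      (pow_one (p : A))
  -- The dual of `ghost_comp_proj`, evaluated on the class of a: the projection contributes the
  -- factor p, and φ contributes the trace.
  have h2 : (extMap D (ghost D (m + 1))).hom (pushClass D (m + 1) (m + 2) (p * a)) =
      (extMap D (res D (m + 1))).hom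
        ((extMap D (ghost D m)).hom (pushClass D m (m + 1) (traceA D a))) := by
    rw [← extMap_frobQ_pushClass, ← extMap_proj_pushClass, ← extMap_comp_apply, ghost_comp_proj,
      extMap_comp_apply, extMap_comp_apply]
  calc _ = (lam D (m + 1)).hom (Ideal.Quotient.mk (Ideal.span {(p : A)} ^ (m + 2)) (p * a)) :=
        congrArg (lam D (m + 1)).hom h1
    _ = _ := lam_mk D (m + 1) (p * a)
    _ = _ := h2
    _ = (T D (m + 1)).hom ((lam D m).hom
        (Ideal.Quotient.mk (Ideal.span {(p : A)} ^ (m + 1)) (traceA D a))) := by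
      rw [lam_mk]
      rfl
    _ = _ := congrArg (fun x => (T D (m + 1)).hom ((lam D m).hom x)) (u_mk D (m + 1) a).symm

/-! ### Compatibility with `V` -/

/-- Multiplication by `p` from `φ_* φ^m_*` of `0 → A → A → A/p^n → 0` to `φ^{m+1}_*` of
`0 → A → A → A/p^{n+1} → 0`. -/
def powSeqPushMulP (m n : ℕ) :
    ((powSeq D n).map (push D m)).map (ModuleCat.restrictScalars D.φ) ⟶
      (powSeq D (n + 1)).map (push D (m + 1)) where
  τ₁ := (pushSucc D m _).inv ≫ (push D (m + 1)).map (powSeqMulP D n).τ₁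
  τ₂ := (pushSucc D m _).inv ≫ (push D (m + 1)).map (powSeqMulP D n).τ₂
  τ₃ := (pushSucc D m _).inv ≫ (push D (m + 1)).map (powSeqMulP D n).τ₃
  comm₁₂ := by
    ext x
    exact congrArg (fun f => f.hom x) (powSeqMulP D n).comm₁₂
  comm₂₃ := by
    ext x
    exact congrArg (fun f => f.hom x) (powSeqMulP D n).comm₂₃

lemma ver_comp_ghost (m : ℕ) :
    ver D (m + 1) ≫ ghost D (m + 1) =
      (ModuleCat.restrictScalars D.φ).map (ghost D m) ≫
        (pushSucc D m _).inv ≫ (push D (m + 1)).map (mulPow p A (m + 1) 1 (m + 2) rfl) := by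
  ext x
  obtain ⟨X, rfl⟩ := reduceW_surjective p A (m + 1) x
  change (ghost D (m + 1)).hom ((ver D (m + 1)).hom (reduceW p A (m + 1) X)) =
    (mulPow p A (m + 1) 1 (m + 2) rfl).hom ((ghost D m).hom (reduceW p A (m + 1) X))
  rw [ver_reduceW, ghost_reduceW, ghost_reduceW, ghostComponent_verschiebung]
  change _ = Ideal.Quotient.mk (Ideal.span {(p : A)} ^ (m + 2)) ((p : A) ^ 1 * _)
  rw [pow_one]

/-- The left component of `powSeqMulP` is the identity, so a is unchanged while p^{n+1} drops to
p^n. The remaining φ_* is the duality map, because the iterated trace is the trace after φ_* of the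
previous iterate. -/
lemma extMap_mulPow_pushClass (k n : ℕ) (a : A) :
    (extMap D ((pushSucc D k _).inv ≫ (push D (k + 1)).map (mulPow p A n 1 (n + 1) rfl))).hom
        (pushClass D (k + 1) (n + 1) a) =
      (duality D ((push D k).obj (QMod p A n))).hom (pushClass D k n a) := by
  refine (extMap_connecting D (((powSeq_shortExact D n).map_of_exact (push D k)).map_of_exact
    (ModuleCat.restrictScalars D.φ)) ((powSeq_shortExact D (n + 1)).map_of_exact (push D (k + 1)))
    (powSeqPushMulP D k n) _).trans ?_
  refine Eq.trans ?_ (dualityMap_connecting D D.φ (trace D)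
    ((powSeq_shortExact D n).map_of_exact (push D k)) _).symm
  rfl

/-- The right square of (C3) before the duality map is inverted, and hence valid without knowing
that it is an isomorphism. -/
theorem lam_comp_extMap_ver (m : ℕ) :
    lam D (m + 1) ≫ extMap D (ver D (m + 1)) =
      ((push D (m + 1)).map (proj p A (m + 1)) ≫ (pushSucc D m (QMod p A (m + 1))).hom ≫
        (ModuleCat.restrictScalars D.φ).map (lam D m)) ≫ duality D (WMod D (m + 1)) := by
  ext a
  obtain ⟨a, rfl⟩ := Ideal.Quotient.mk_surjective a
  change (extMap D (ver D (m + 1))).hom ((lam D (m + 1)).hom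
    (Ideal.Quotient.mk (Ideal.span {(p : A)} ^ (m + 2)) a)) =
      (duality D (WMod D (m + 1))).hom ((lam D m).hom
        (Ideal.Quotient.mk (Ideal.span {(p : A)} ^ (m + 1)) a))
  rw [lam_mk, lam_mk, ← extMap_dualityMap, ← extMap_mulPow_pushClass, ← extMap_comp_apply,
    ← extMap_comp_apply, ver_comp_ghost]

/-! ### Compatibility with `T^m` -/

/-- The identity from `φ^0_*` of `0 → A → A → A/p^n → 0` to itself. -/
def powSeqPushZero (n : ℕ) : (powSeq D n).map (push D 0) ⟶ powSeq D n where
  τ₁ := (ModuleCat.restrictScalarsId'App (D.φ ^ 0) (pow_zero D.φ) _).hom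
  τ₂ := (ModuleCat.restrictScalarsId'App (D.φ ^ 0) (pow_zero D.φ) _).hom
  τ₃ := (ModuleCat.restrictScalarsId'App (D.φ ^ 0) (pow_zero D.φ) _).hom
  comm₁₂ := rfl
  comm₂₃ := rfl

/-- Each use of (C2) removes one factor p at the cost of one T and one trace; the trace passes
through the remaining power of p. -/
lemma lam_natCast_pow_mul (m : ℕ) (a : A) :
    (lam D m).hom (Ideal.Quotient.mk (Ideal.span {(p : A)} ^ (m + 1)) ((p : A) ^ m * a)) =
      (TIter D m).hom ((iota D 1).hom.hom
        (Ideal.Quotient.mk (Ideal.span {(p : A)} ^ 1) ((traceA D)^[m] a))) := by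
  induction m generalizing a with
  | zero =>
    have h : (extMap D (ModuleCat.restrictScalarsId'App (D.φ ^ 0) (pow_zero D.φ)
        (QMod p A 1)).hom).hom (connecting D (powSeq_shortExact D 1) (iotaMul D a)) =
          pushClass D 0 1 a :=
      extMap_connecting D ((powSeq_shortExact D 1).map_of_exact (push D 0))
        (powSeq_shortExact D 1) (powSeqPushZero D 1) _
    have h1 : (p : A) ^ 0 * a = a := by rw [pow_zero, one_mul]
    rw [lam_mk, h1, Function.iterate_zero, id, iota_hom_mk, TIter, extMap_comp_apply, h]
  | succ m ih =>
    have h := lam_mul_p D m (Ideal.Quotient.mk (Ideal.span {(p : A)} ^ (m + 1)) ((p : A) ^ m * a))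
    rw [u_mk, traceA_natCast_pow_mul, ih, ← Function.iterate_succ_apply] at h
    refine Eq.trans ?_ h
    exact congrArg (fun x : A => (lam D (m + 1)).hom
      (Ideal.Quotient.mk (Ideal.span {(p : A)} ^ (m + 2)) x))
        (by ring : (p : A) ^ (m + 1) * a = (p : A) ^ 1 * ((p : A) ^ m * a))

theorem mulPow_comp_lam (m : ℕ) :
    (push D m).map (mulPow p A 1 m (m + 1) (by omega)) ≫ lam D m =
      (uIter D 1 m ≫ (iota D 1).hom) ≫ TIter D m := by
  ext a
  obtain ⟨a, rfl⟩ := Ideal.Quotient.mk_surjective a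
  refine (lam_natCast_pow_mul D m a).trans ?_
  rw [← uIter_mk]
  rfl

/-! ### The sequence `0 → φ_* W_n(A/p) → W_{n+1}(A/p) → A/p → 0` -/

/-- The `m`-fold restriction map `W_{m+1}(A/p) → W_1(A/p) = A/p`. -/
def resIter : (m : ℕ) → (WMod D (m + 1) ⟶ QMod p A 1)
  | 0 => ghost D 0 ≫ (ModuleCat.restrictScalarsId'App (D.φ ^ 0) (pow_zero D.φ) (QMod p A 1)).hom
  | m + 1 => res D (m + 1) ≫ resIter m

lemma TIter_eq_extMap (m : ℕ) : TIter D m = extMap D (resIter D m) := by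
  induction m with
  | zero => rfl
  | succ m ih => rw [TIter, resIter, extMap_comp, ih, T]

lemma resIter_reduceW (m : ℕ) (X : WittVector p A) :
    (resIter D m).hom (reduceW p A (m + 1) X) =
      Ideal.Quotient.mk (Ideal.span {(p : A)} ^ 1) (X.coeff 0) := by
  induction m with
  | zero =>
    refine (ghost_reduceW D 0 X).trans ?_
    rw [ghostComponent_apply, aeval_wittPolynomial]
    simp
    rfl
  | succ m ih =>
    rw [← ih, ← res_reduceW D (m + 1) X]
    rfl

lemma reduceW_eq_zero_iff (n : ℕ) (X : WittVector p A) :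
    reduceW p A n X = 0 ↔ ∀ i < n, (p : A) ∣ X.coeff i := by
  have h : reduceW p A n X = 0 ↔ WittVector.map (Ideal.Quotient.mk (Ideal.span {(p : A)})) X ∈
    RingHom.ker (WittVector.truncate (p := p) (R := A ⧸ Ideal.span {(p : A)}) n) := Iff.rfl
  rw [h, WittVector.mem_ker_truncate]
  simp only [map_coeff, Ideal.Quotient.eq_zero_iff_mem, Ideal.mem_span_singleton]

lemma ver_comp_resIter (m : ℕ) : ver D (m + 1) ≫ resIter D (m + 1) = 0 := by
  ext x
  obtain ⟨X, rfl⟩ := reduceW_surjective p A (m + 1) x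
  change (resIter D (m + 1)).hom ((ver D (m + 1)).hom (reduceW p A (m + 1) X)) = 0
  rw [ver_reduceW, resIter_reduceW, verschiebung_coeff_zero, map_zero]
  rfl

/-- The sequence `0 → φ_* W_{m+1}(A/p) → W_{m+2}(A/p) → A/p → 0` is exact. -/
lemma ver_resIter_shortExact (m : ℕ) :
    (ShortComplex.mk _ _ (ver_comp_resIter D m)).ShortExact where
  exact := by
    rw [ShortComplex.moduleCat_exact_iff]
    intro x hx
    obtain ⟨X, rfl⟩ := reduceW_surjective p A (m + 2) x
    have h0 : (p : A) ∣ X.coeff 0 := by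
      have h := (resIter_reduceW D (m + 1) X).symm.trans hx
      have h1 := (Ideal.Quotient.eq_zero_iff_mem (I := Ideal.span {(p : A)} ^ 1)).mp h
      rwa [pow_one, Ideal.mem_span_singleton] at h1
    -- If p divides the zeroth coordinate, X and V of its shift have the same reduction, although
    -- they may differ in W(A).
    have h1 : WittVector.map (Ideal.Quotient.mk (Ideal.span {(p : A)}))
        (verschiebung (X.shift 1)) = WittVector.map (Ideal.Quotient.mk _) X := by
      ext i
      rw [map_coeff, map_coeff]
      cases i with
      | zero =>
        rw [verschiebung_coeff_zero, map_zero]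
        exact (Ideal.Quotient.eq_zero_iff_mem.mpr (Ideal.mem_span_singleton.mpr h0)).symm
      | succ i => rw [verschiebung_coeff_add_one, shift_coeff, add_comm]
    exact ⟨reduceW p A (m + 1) (X.shift 1), (ver_reduceW D (m + 1) _).trans
      (congrArg (WittVector.truncate (m + 2)) h1)⟩
  mono_f := by
    rw [ModuleCat.mono_iff_injective, injective_iff_map_eq_zero]
    intro x hx
    obtain ⟨X, rfl⟩ := reduceW_surjective p A (m + 1) x
    have h := (reduceW_eq_zero_iff (m + 2) (verschiebung X)).mp
      ((ver_reduceW D (m + 1) X).symm.trans hx)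
    refine (reduceW_eq_zero_iff _ _).mpr fun i hi => ?_
    have := h (i + 1) (by omega)
    rwa [verschiebung_coeff_add_one] at this
  epi_g := by
    rw [ModuleCat.epi_iff_surjective]
    intro x
    obtain ⟨a, rfl⟩ := Ideal.Quotient.mk_surjective x
    refine ⟨reduceW p A (m + 2) (teichmuller p a), (resIter_reduceW D (m + 1) _).trans ?_⟩
    rw [teichmuller_coeff_zero]

/-! ### Exactness of the rows -/

/-- In characteristic p, multiplication by p is VF, so p^n kills the first n coordinates. -/
lemma natCast_pow_smul_W (n : ℕ) (x : W p A n) : p ^ n • x = 0 := by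
  obtain ⟨x, rfl⟩ := WittVector.truncate_surjective p n _ x
  rw [← map_nsmul, ← RingHom.mem_ker, mem_ker_truncate]
  intro i hi
  -- The zero ring, which occurs when p is a unit, does not have characteristic p and is treated
  -- apart.
  rcases subsingleton_or_nontrivial (A ⧸ Ideal.span {(p : A)}) with h | h
  · exact Subsingleton.elim _ _
  have : CharP (A ⧸ Ideal.span {(p : A)}) p := by
    refine (CharP.charP_iff_prime_eq_zero hp.out).mpr ?_
    rw [← map_natCast (Ideal.Quotient.mk (Ideal.span {(p : A)})), Ideal.Quotient.eq_zero_iff_mem]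
    exact Ideal.mem_span_singleton_self _
  rw [nsmul_eq_mul, mul_comm, Nat.cast_pow]
  exact mul_pow_charP_coeff_zero x hi

set_option linter.unusedSectionVars false in
/-- A module which is killed by a power of `p` has no non-zero maps to `ω`. -/
lemma hom_eq_zero_of_nsmul {M : ModuleCat.{u} A} (n : ℕ) (hM : ∀ x : M, p ^ n • x = 0)
    (g : M ⟶ D.ω) : g = 0 := by
  ext x
  have h1 : p ^ n • D.ι.inv.hom (g.hom x) = 0 := by
    rw [← map_nsmul, ← map_nsmul, hM, map_zero, map_zero]
  have h2 : D.ι.inv.hom (g.hom x) = (0 : A) := by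
    refine (mul_cancel_left_mem_nonZeroDivisors (pow_mem D.torsionFree n)).mp ?_
    rw [mul_zero, ← Nat.cast_pow, ← nsmul_eq_mul]
    exact h1
  change g.hom x = 0
  rw [← iota_inv_iota_hom D (g.hom x), h2, map_zero]

/-- A/p^n has a free resolution of length one. -/
lemma ext_two_QMod_eq_zero (n : ℕ) (e : Ext (QMod p A n) D.ω 2) : e = 0 := by
  have hproj : Projective (powSeq D n).X₂ :=
    ModuleCat.projective_of_free (Module.Basis.singleton Unit A)
  have hproj' : Projective (powSeq D n).X₁ := hproj
  obtain ⟨y, hy⟩ := Ext.contravariant_sequence_exact₃ (powSeq_shortExact D n) D.ω e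
    (Ext.eq_zero_of_projective _) (n₀ := 1) rfl
  rw [← hy, Ext.eq_zero_of_projective y, Ext.comp_zero]

/-- The sequence dual to `0 → φ_* W_{m+1}(A/p) → W_{m+2}(A/p) → A/p → 0` is exact. -/
lemma isShortExact_TIter_extMap_ver (m : ℕ) :
    IsShortExact (TIter D (m + 1)) (extMap D (ver D (m + 1))) := by
  have hS := ver_resIter_shortExact D m
  rw [TIter_eq_extMap]
  refine ⟨?_, { exact := ?_, mono_f := ?_, epi_g := ?_ }⟩
  · rw [← extMap_comp, ver_comp_resIter]
    ext (e : Ext _ _ _)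
    change (Ext.mk₀ 0).comp e (zero_add 1) = 0
    rw [Ext.mk₀_zero, Ext.zero_comp]
  · rw [ShortComplex.moduleCat_exact_iff]
    intro (e : Ext _ D.ω 1) he
    exact Ext.contravariant_sequence_exact₂ hS D.ω e he
  · rw [ModuleCat.mono_iff_injective, injective_iff_map_eq_zero]
    intro (e : Ext _ D.ω 1) he
    obtain ⟨g, rfl⟩ := Ext.contravariant_sequence_exact₃ hS D.ω e he (n₀ := 0) rfl
    obtain ⟨g, rfl⟩ := (Ext.mk₀_bijective _ _).2 g
    -- The kernel comes from Hom(φ_*W_{m+1}(A/p), ω), whose source is killed by p^{m+1}; restriction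
    -- of scalars does not alter integer multiples.
    rw [hom_eq_zero_of_nsmul D (m + 1) (fun x => natCast_pow_smul_W (m + 1) x) g]
    exact (congrArg (fun t => hS.extClass.comp t (add_zero 1)) (Ext.mk₀_zero _ _)).trans
      (Ext.comp_zero _ _ _ _ _)
  · rw [ModuleCat.epi_iff_surjective]
    intro (e : Ext _ D.ω 1)
    exact Ext.contravariant_sequence_exact₁ hS D.ω e (n₁ := 2) rfl (ext_two_QMod_eq_zero D 1 _)

set_option linter.unusedSectionVars false in
lemma IsShortExact.comp_iso {X Y Z Z' : ModuleCat.{u} A} {f : X ⟶ Y} {g : Y ⟶ Z}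
    (h : IsShortExact f g) (e : Z ⟶ Z') [IsIso e] : IsShortExact f (g ≫ e) := by
  obtain ⟨w, h⟩ := h
  have w' : f ≫ g ≫ e = 0 := by rw [← Category.assoc, w, Limits.zero_comp]
  exact ⟨w', ShortComplex.shortExact_of_iso
    (ShortComplex.isoMk (S₁ := ShortComplex.mk f g w) (S₂ := ShortComplex.mk f (g ≫ e) w')
      (Iso.refl X) (Iso.refl Y) (asIso e) (by simp) (by simp)) h⟩

set_option linter.unusedSectionVars false in
lemma IsShortExact.map_push {X Y Z : ModuleCat.{u} A} {f : X ⟶ Y} {g : Y ⟶ Z}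
    (h : IsShortExact f g) (k : ℕ) : IsShortExact ((push D k).map f) ((push D k).map g) := by
  obtain ⟨w, h⟩ := h
  exact ⟨by rw [← Functor.map_comp, w, Functor.map_zero], h.map_of_exact (push D k)⟩

set_option linter.unusedSectionVars false in
lemma isShortExact_mulPow_proj (htf : (p : A) ∈ nonZeroDivisors A) (m : ℕ) :
    IsShortExact (mulPow p A 1 m (m + 1) (by omega)) (proj p A m) := by
  have hmem : ∀ (n : ℕ) (a : A), Ideal.Quotient.mk (Ideal.span {(p : A)} ^ n) a = 0 ↔
      (p : A) ^ n ∣ a := fun n a => by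
    rw [Ideal.Quotient.eq_zero_iff_mem, Ideal.span_singleton_pow, Ideal.mem_span_singleton]
  refine ⟨?_, { exact := ?_, mono_f := ?_, epi_g := ?_ }⟩
  · ext a
    obtain ⟨a, rfl⟩ := Ideal.Quotient.mk_surjective a
    exact (hmem m ((p : A) ^ m * a)).mpr (Dvd.intro _ rfl)
  · rw [ShortComplex.moduleCat_exact_iff]
    intro a ha
    obtain ⟨a, rfl⟩ := Ideal.Quotient.mk_surjective a
    obtain ⟨b, rfl⟩ := (hmem m a).mp ha
    exact ⟨Ideal.Quotient.mk _ b, rfl⟩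
  · rw [ModuleCat.mono_iff_injective, injective_iff_map_eq_zero]
    intro a ha
    obtain ⟨a, rfl⟩ := Ideal.Quotient.mk_surjective a
    obtain ⟨b, hb⟩ := (hmem (m + 1) ((p : A) ^ m * a)).mp ha
    rw [pow_succ, mul_assoc] at hb
    refine (hmem 1 a).mpr ⟨b, ?_⟩
    rw [pow_one]
    exact (mul_cancel_left_mem_nonZeroDivisors (pow_mem htf m)).mp hb
  · rw [ModuleCat.epi_iff_surjective]
    intro a
    obtain ⟨a, rfl⟩ := Ideal.Quotient.mk_surjective a
    exact ⟨Ideal.Quotient.mk _ a, rfl⟩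

end WittDual
end

/-! ### The properties (C1), (C2) and (C3). -/

open WittDual in
theorem mainTheorem6 {p : ℕ} [Fact p.Prime] {A : Type u} [CommRing A] [IsRegularLocalRing A]
    (D : DualizingDatum p A) :
    -- (C1), with `n = m + 1`; for `r > m` both sides vanish, whatever the exponent of `b`
    (∀ (m r : ℕ) (a b : Q p A (m + 1)),
      verTeich m r b • (lam D m).hom a =
        (p : A) ^ r • (lam D m).hom (a * b ^ p ^ (m - r))) ∧
    -- (C2), with `n = m + 2`
    (∀ (m : ℕ) (a : Q p A (m + 1)),
      (lam D (m + 1)).hom ((mulPow p A (m + 1) 1 (m + 2) rfl).hom a) =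
        (T D (m + 1)).hom ((lam D m).hom ((WittDual.u D (m + 1)).hom a))) ∧
    -- (C3), with `n = m + 2`
    (∀ m : ℕ, ∃ _ : IsIso (duality D (WMod D (m + 1))),
      IsShortExact ((push D (m + 1)).map (mulPow p A 1 (m + 1) (m + 2) (by omega)))
        ((push D (m + 1)).map (proj p A (m + 1))) ∧
      IsShortExact (TIter D (m + 1)) (verDual D (m + 1)) ∧
      (push D (m + 1)).map (mulPow p A 1 (m + 1) (m + 2) (by omega)) ≫ lam D (m + 1) =
        (uIter D 1 (m + 1) ≫ (iota D 1).hom) ≫ TIter D (m + 1) ∧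
      lam D (m + 1) ≫ verDual D (m + 1) =
        (push D (m + 1)).map (proj p A (m + 1)) ≫ (pushSucc D m (QMod p A (m + 1))).hom ≫
          (ModuleCat.restrictScalars D.φ).map (lam D m)) := by
  refine ⟨verTeich_smul_lam D, lam_mul_p D, fun m => ?_⟩
  have hiso := isIso_duality_WMod D (m + 1)
  refine ⟨hiso, (isShortExact_mulPow_proj D.torsionFree (m + 1)).map_push D (m + 1),
    (isShortExact_TIter_extMap_ver D m).comp_iso (inv (duality D (WMod D (m + 1)))),
    mulPow_comp_lam D (m + 1), ?_⟩
  -- Cancelling the duality isomorphism turns the square for Ext^1(V, ω) into the square for V^*.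
  rw [verDual, ← Category.assoc, lam_comp_extMap_ver, Category.assoc, IsIso.hom_inv_id,
    Category.comp_id]
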